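/- Let $\mathcal C$ be a rigid C*-tensor category with simple unit object $\mathbb 1$, closed under finite direct sums and subobjects (an object is simple if its endomorphisms are the scalars $\mathbb C$). Let $\mathbf{Irr}\ni\mathbb 1$ be a set of representatives of the isomorphism classes of simple objects, with fixed conjugates $\bar k\in\mathbf{Irr}$ and fixed standard solutions $R_k:\mathbb 1\to\bar k\otimes k$, $\bar R_k:\mathbb 1\to k\otimes\bar k$ of the conjugate equations, for $k\in\mathbf{Irr}$. Here a solution $(R,\bar R)$ of the conjugate equations for an object $X$ and a conjugate $\bar X$ is standard if $R^*(1\otimes f)R=\bar R^*(f\otimes 1)\bar R$ for all $f\in\mathrm{End}(X)$; then $d(X)$ is the scalar with $R^*R=d(X)1_{\mathbb 1}$. The fusion algebra $\mathbb C[\mathcal C]$ has basis $\mathbf{Irr}$, product $x\cdot y=\sum_{z}\dim\mathcal C(z,x\otimes y)\,z$, and conjugate-linear involution $x\mapsto\bar x$. For $x,y\in\mathbf{Irr}$ let $\mathcal A_{x,y}=\bigoplus_{w\in\mathbf{Irr}}\mathcal C(w\otimes x,y\otimes w)$ be the components of the tube algebra, with $$(f\cdot g)^k=\sum_{m,l\in\mathbf{Irr}}\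 \sum_{V\in\mathrm{onb}\,\mathcal C(k,m\otimes l)}(1_j\otimes V^*)(f^m\otimes1_l)(1_m\otimes g^l)(V\otimes1_i)\qquad(f\in\mathcal A_{s,j},\ g\in\mathcal A_{i,s}),$$ $$(f^*)^k=(\bar R_k^*\otimes1_i\otimes1_k)(1_k\otimes(f^{\bar k})^*\otimes1_k)(1_k\otimes1_j\otimes R_k)\in\mathcal C(k\otimes j,i\otimes k)\qquad(f\in\mathcal A_{i,j}),$$ where orthonormal bases of $\mathcal C(w,z)$, $w$ simple, refer to the inner product $\langle\sigma,\tau\rangle1_w=\tau^*\sigma$. For an object $z$ and $\gamma\in\mathcal C(z\otimes x,y\otimes z)$ let $\Psi^z_{x,y}(\gamma)\in\mathcal A_{x,y}$ have components $\sum_{\alpha\in\mathrm{onb}\,\mathcal C(w,z)}(1_y\otimes\alpha^*)\gamma(\alpha\otimes1_x)$. Identify $\mathbb C[\mathcal C]$ with $\mathcal A_{\mathbb 1,\mathbb 1}$ through $w\mapsto 1_w\in\mathcal C(w\otimes\mathbb 1,\mathbb 1\otimes w)$, and let the tube cone $\Sigma^2\mathcal C\subset\mathbb C[\mathcal C]$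 be the set of finite sums of elements $aa^*$ with $a\in\mathcal A_{x,\mathbb 1}$, $x\in\mathbf{Irr}$ (which may vary). Write $a\le b$ if $b-a\in\Sigma^2\mathcal C$. Then: 1. For every self-adjoint $a\in\mathbb C[\mathcal C]$ there is a real $R>0$ with $a+R\,\mathbb 1\in\Sigma^2\mathcal C$; that is, $\mathbb 1$ is an order unit. 2. Let $x\in\mathbf{Irr}$, let $z$ be an object with a standard solution $(R,\bar R)$ for $(z,\bar z)$, let $\gamma\in\mathcal C(z,x\otimes z)$, and put $b=\Psi^z_{\mathbb 1,x}(\gamma)\in\mathcal A_{\mathbb 1,x}$. Let $\sigma=(\gamma^*\otimes1_{\bar z})(1_x\otimes\bar R\bar R^*)(\gamma\otimes1_{\bar z})\in\mathrm{End}(z\otimes\bar z)$. Then $b^*b\le\|\sigma\|\,d(z)\,\mathbb 1$. 3. For every $z\in\mathbf{Irr}$, $\bar z\cdot z\le d(z)^2\,\mathbb 1$. -/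

import Mathlib

open CategoryTheory MonoidalCategory

universe v u

/-- A C*-category: a `ℂ`-linear category whose morphism spaces are Banach spaces, with a conjugate
linear, contravariant, involutive operation `dag` (written `f†`) that is the identity on objects,
with a submultiplicative norm satisfying the C*-identity, and such that `f† f` is a positive element
of the C*-algebra of endomorphisms of the source of `f`, i.e. of the form `g† g` with
`g` an endomorphism. Composition is written in diagrammatic order (`f ≫ g` is `g` after `f`). -/
class CStarCategory (C : Type u) [Category.{v} C] [Preadditive C] [Linear ℂ C] where
  dag : ∀ {X Y : C}, (X ⟶ Y) → (Y ⟶ X)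
  dag_dag : ∀ {X Y : C} (f : X ⟶ Y), dag (dag f) = f
  dag_id : ∀ X : C, dag (𝟙 X) = 𝟙 X
  dag_comp : ∀ {X Y Z : C} (f : X ⟶ Y) (g : Y ⟶ Z), dag (f ≫ g) = dag g ≫ dag f
  dag_add : ∀ {X Y : C} (f g : X ⟶ Y), dag (f + g) = dag f + dag g
  dag_smul : ∀ {X Y : C} (c : ℂ) (f : X ⟶ Y), dag (c • f) = (starRingEnd ℂ c) • dag f
  hnorm : ∀ {X Y : C}, (X ⟶ Y) → ℝ
  hnorm_nonneg : ∀ {X Y : C} (f : X ⟶ Y), 0 ≤ hnorm f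
  hnorm_eq_zero : ∀ {X Y : C} (f : X ⟶ Y), hnorm f = 0 ↔ f = 0
  hnorm_add_le : ∀ {X Y : C} (f g : X ⟶ Y), hnorm (f + g) ≤ hnorm f + hnorm g
  hnorm_smul : ∀ {X Y : C} (c : ℂ) (f : X ⟶ Y), hnorm (c • f) = ‖c‖ * hnorm f
  complete : ∀ {X Y : C} (s : ℕ → (X ⟶ Y)),
    (∀ ε : ℝ, 0 < ε → ∃ N, ∀ m ≥ N, ∀ n ≥ N, hnorm (s m - s n) < ε) →
      ∃ f : X ⟶ Y, ∀ ε : ℝ, 0 < ε → ∃ N, ∀ n ≥ N, hnorm (s n - f) < ε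
  hnorm_comp_le : ∀ {X Y Z : C} (f : X ⟶ Y) (g : Y ⟶ Z), hnorm (f ≫ g) ≤ hnorm f * hnorm g
  cstar_identity : ∀ {X Y : C} (f : X ⟶ Y), hnorm (f ≫ dag f) = hnorm f ^ 2
  dag_comp_self_positive : ∀ {X Y : C} (f : X ⟶ Y), ∃ g : X ⟶ X, f ≫ dag f = g ≫ dag g

postfix:max "†" => CStarCategory.dag

section Linear

variable {C : Type u} [Category.{v} C] [Preadditive C] [Linear ℂ C]

/-- An object is simple when its endomorphisms are exactly the scalars `ℂ`. -/
def IsSimpleObj (X : C) : Prop :=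
  𝟙 X ≠ 0 ∧ ∀ f : X ⟶ X, ∃ c : ℂ, f = c • 𝟙 X

instance [CStarCategory C] (X Y : C) : Norm (X ⟶ Y) := ⟨CStarCategory.hnorm⟩

end Linear

/-- A C*-tensor category with simple unit, closed under finite direct sums and subobjects (the zero
object is the subobject given by the projection `0`). The tensor product is bilinear and
compatible with `dag`, and the associators and unitors are unitary. Strict
categories are the special case in which the structure isomorphisms are identities. -/
class CStarTensorCategory (C : Type u) [Category.{v} C] [Preadditive C] [Linear ℂ C]
    [MonoidalCategory C] extends
    CStarCategory C, MonoidalPreadditive C, MonoidalLinear ℂ C where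
  dag_tensor : ∀ {X Y X' Y' : C} (f : X ⟶ Y) (g : X' ⟶ Y'), (f ⊗ₘ g)† = f† ⊗ₘ g†
  dag_associator : ∀ X Y Z : C, ((α_ X Y Z).hom)† = (α_ X Y Z).inv
  dag_leftUnitor : ∀ X : C, ((λ_ X).hom)† = (λ_ X).inv
  dag_rightUnitor : ∀ X : C, ((ρ_ X).hom)† = (ρ_ X).inv
  unit_simple : IsSimpleObj (𝟙_ C)
  exists_directSum : ∀ X Y : C, ∃ (Z : C) (i : X ⟶ Z) (j : Y ⟶ Z),
    i ≫ i† = 𝟙 X ∧ j ≫ j† = 𝟙 Y ∧ i† ≫ i + j† ≫ j = 𝟙 Z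
  exists_subobject : ∀ (X : C) (p : X ⟶ X), p ≫ p = p → p† = p →
    ∃ (Y : C) (i : Y ⟶ X), i ≫ i† = 𝟙 Y ∧ i† ≫ i = p

section Tensor

variable {C : Type u} [Category.{v} C] [Preadditive C] [Linear ℂ C] [MonoidalCategory C]
  [CStarTensorCategory C]

/-- `(R, Rbar)` solves the conjugate equations for the pair `(X, Xbar)`. -/
def ConjugateEquations {X Xbar : C} (R : 𝟙_ C ⟶ Xbar ⊗ X) (Rbar : 𝟙_ C ⟶ X ⊗ Xbar) : Prop :=
  (λ_ Xbar).inv ≫ R ▷ Xbar ≫ (α_ Xbar X Xbar).hom ≫ Xbar ◁ Rbar† ≫ (ρ_ Xbar).hom = 𝟙 Xbar ∧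
  (λ_ X).inv ≫ Rbar ▷ X ≫ (α_ X Xbar X).hom ≫ X ◁ R† ≫ (ρ_ X).hom = 𝟙 X

/-- A standard solution of the conjugate equations: the left and the right trace agree. -/
def IsStandard {X Xbar : C} (R : 𝟙_ C ⟶ Xbar ⊗ X) (Rbar : 𝟙_ C ⟶ X ⊗ Xbar) : Prop :=
  ConjugateEquations R Rbar ∧
  ∀ f : X ⟶ X, R ≫ Xbar ◁ f ≫ R† = Rbar ≫ f ▷ Xbar ≫ Rbar†

/-- The scalar `c` with `f = c • 𝟙`, for an endomorphism `f` of the (simple) unit object. -/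
noncomputable def unitScalar (f : 𝟙_ C ⟶ 𝟙_ C) : ℂ :=
  Classical.choose ((CStarTensorCategory.unit_simple (C := C)).2 f)

/-- The categorical dimension `d(X)`, where `R† R = d(X) 𝟙` (a nonnegative real number), for `R` the
first component of a standard solution `(R, Rbar)` for `(X, Xbar)`. -/
noncomputable def catDim {X Xbar : C} (R : 𝟙_ C ⟶ Xbar ⊗ X) : ℝ := (unitScalar (R ≫ R†)).re

/-- `S` is an orthonormal basis of the space of morphisms from `w` to `z`, for the inner product
`⟨σ, τ⟩ 𝟙 = τ† σ` (`w` simple). -/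
def IsOnb {w z : C} (S : Set (w ⟶ z)) : Prop :=
  (∀ V ∈ S, V ≫ V† = 𝟙 w) ∧ (∀ V ∈ S, ∀ W ∈ S, V ≠ W → W ≫ V† = 0) ∧ Submodule.span ℂ S = ⊤

/-- A choice of an orthonormal basis of the morphisms from `w` to `z` (it exists and is finite for
`w` simple when conjugates exist, the morphism spaces being finite-dimensional then). -/
noncomputable def onb (w z : C) : Set (w ⟶ z) := Classical.epsilon IsOnb

end Tensor

/-- Rigidity: every object has a conjugate. -/
class IsRigid (C : Type u) [Category.{v} C] [Preadditive C] [Linear ℂ C] [MonoidalCategory C]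
    [CStarTensorCategory C] : Prop where
  exists_conjugate : ∀ X : C, ∃ (Xbar : C) (R : 𝟙_ C ⟶ Xbar ⊗ X) (Rbar : 𝟙_ C ⟶ X ⊗ Xbar),
    ConjugateEquations R Rbar

/-- A choice of a set `Irr` of representatives of the isomorphism classes of simple objects, with
the unit object among them, of conjugates inside `Irr`, and of standard
solutions of the conjugate equations for them. -/
structure IrrChoice (C : Type u) [Category.{v} C] [Preadditive C] [Linear ℂ C]
    [MonoidalCategory C] [CStarTensorCategory C] where
  Irr : Set C
  simple : ∀ X ∈ Irr, IsSimpleObj X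
  unit_mem : 𝟙_ C ∈ Irr
  exists_iso : ∀ X : C, IsSimpleObj X → ∃ Y ∈ Irr, Nonempty (X ≅ Y)
  eq_of_iso : ∀ X ∈ Irr, ∀ Y ∈ Irr, Nonempty (X ≅ Y) → X = Y
  bar : Irr → Irr
  R : ∀ k : Irr, 𝟙_ C ⟶ (bar k : C) ⊗ (k : C)
  Rbar : ∀ k : Irr, 𝟙_ C ⟶ (k : C) ⊗ (bar k : C)
  standard : ∀ k : Irr, IsStandard (R k) (Rbar k)

namespace IrrChoice

variable {C : Type u} [Category.{v} C] [Preadditive C] [Linear ℂ C] [MonoidalCategory C]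
  [CStarTensorCategory C] (D : IrrChoice C)

/-- The fusion algebra `ℂ[C]`: the complex vector space with basis `Irr`. -/
def FusionAlgebra : Type _ := D.Irr →₀ ℂ

noncomputable instance : AddCommGroup D.FusionAlgebra :=
  inferInstanceAs (AddCommGroup (D.Irr →₀ ℂ))

noncomputable instance : Module ℂ D.FusionAlgebra :=
  inferInstanceAs (Module ℂ (D.Irr →₀ ℂ))

/-- The basis element of the fusion algebra given by a simple object. -/
noncomputable def of (x : D.Irr) : D.FusionAlgebra := Finsupp.single x (1 : ℂ)

/-- The coefficient of an element of the fusion algebra at a simple object. -/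
def coeff (a : D.FusionAlgebra) : D.Irr →₀ ℂ := a

/-- The unit of the fusion algebra is the class of the unit object. -/
noncomputable instance : One D.FusionAlgebra := ⟨D.of ⟨𝟙_ C, D.unit_mem⟩⟩

/-- The fusion rules `x · y = ∑ z, dim C(z, x ⊗ y) z` (a finite sum), extended bilinearly. -/
noncomputable instance : Mul D.FusionAlgebra :=
  ⟨fun a b => (D.coeff a).sum fun x r => (D.coeff b).sum fun y s =>
    (r * s) • ∑ᶠ z : D.Irr,
      (Module.finrank ℂ ((z : C) ⟶ (x : C) ⊗ (y : C)) : ℂ) • D.of z⟩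

/-- The involution: `x ↦ x̄` on simple objects, extended conjugate linearly. -/
noncomputable instance : Star D.FusionAlgebra :=
  ⟨fun a => (D.coeff a).sum fun x r => (starRingEnd ℂ r) • D.of (D.bar x)⟩

/-- Families `(f w)` with `f w` a morphism from `w ⊗ x` to `y ⊗ w`, indexed by `w` in `Irr`. -/
abbrev Fam (x y : C) : Type _ := ∀ w : D.Irr, ((w : C) ⊗ x ⟶ y ⊗ (w : C))

/-- The space `A_{x,y} = ⨁ w, C(w ⊗ x, y ⊗ w)`: the families with finitely many nonzero terms. For
`x`, `y` in `Irr`, these are the direct summands of the tube algebra of `C`. -/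
def tube (x y : C) : Set (D.Fam x y) := {f | {w | f w ≠ 0}.Finite}

/-- The tube algebra multiplication `A_{s,j} × A_{i,s} → A_{i,j}`,
`(f · g)^k = ∑ m, l, ∑ V ∈ onb(k, m ⊗ l), (1_j ⊗ V†) (f^m ⊗ 1_l) (1_m ⊗ g^l) (V ⊗ 1_i)`.
All sums are finite when `f` and `g` are finitely supported. -/
noncomputable def tubeMul {i s j : C} (f : D.Fam s j) (g : D.Fam i s) : D.Fam i j := fun k =>
  ∑ᶠ (m : D.Irr) (l : D.Irr) (V : (k : C) ⟶ (m : C) ⊗ (l : C)) (_ : V ∈ onb (k : C) (m ⊗ l : C)),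
    V ▷ i ≫ (α_ (m : C) (l : C) i).hom ≫ (m : C) ◁ g l ≫ (α_ (m : C) s (l : C)).inv ≫
      f m ▷ (l : C) ≫ (α_ j (m : C) (l : C)).hom ≫ j ◁ V†

/-- The tube algebra involution `A_{i,j} → A_{j,i}`,
`(f^*)^k = (R̄_k† ⊗ 1_i ⊗ 1_k) (1_k ⊗ (f^k̄)† ⊗ 1_k) (1_k ⊗ 1_j ⊗ R_k)`. -/
def tubeStar {i j : C} (f : D.Fam i j) : D.Fam j i := fun k =>
  (ρ_ ((k : C) ⊗ j)).inv ≫ ((k : C) ⊗ j) ◁ D.R k ≫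
    (α_ (k : C) j ((D.bar k : C) ⊗ (k : C))).hom ≫ (k : C) ◁ (α_ j (D.bar k : C) (k : C)).inv ≫
    (k : C) ◁ ((f (D.bar k))† ▷ (k : C)) ≫
    (k : C) ◁ (α_ (D.bar k : C) i (k : C)).hom ≫
    (α_ (k : C) (D.bar k : C) (i ⊗ (k : C))).inv ≫
    (D.Rbar k)† ▷ (i ⊗ (k : C)) ≫ (λ_ (i ⊗ (k : C))).hom

/-- The canonical map `Ψ^z_{x,y} : C(z ⊗ x, y ⊗ z) → A_{x,y}`,
`Ψ(γ)^w = ∑ α ∈ onb(w, z), (1_y ⊗ α†) γ (α ⊗ 1_x)`. -/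
noncomputable def Psi {x y z : C} (γ : z ⊗ x ⟶ y ⊗ z) : D.Fam x y := fun w =>
  ∑ᶠ (a : (w : C) ⟶ z) (_ : a ∈ onb (w : C) z), a ▷ x ≫ γ ≫ y ◁ a†

/-- The identification of the fusion algebra with `A_{𝟙,𝟙}`: a simple object `w` goes to the
identity of `w`, seen as an element of the summand `C(w ⊗ 𝟙, 𝟙 ⊗ w)`. -/
noncomputable def toTube (a : D.FusionAlgebra) : D.Fam (𝟙_ C) (𝟙_ C) := fun w =>
  D.coeff a w • ((ρ_ (w : C)).hom ≫ (λ_ (w : C)).inv)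

/-- The tube cone, as a subset of `A_{𝟙,𝟙}`: finite sums of elements `a a^*` with
`a ∈ A_{x,𝟙}`, where `x` may vary in `Irr`. -/
def tubeCone : Set (D.Fam (𝟙_ C) (𝟙_ C)) :=
  {c | ∃ (n : ℕ) (x : Fin n → D.Irr) (a : ∀ i, D.Fam (x i : C) (𝟙_ C)),
    (∀ i, a i ∈ D.tube (x i : C) (𝟙_ C)) ∧ c = ∑ i, D.tubeMul (a i) (D.tubeStar (a i))}

/-- The tube cone `Σ²C` as a subset of the fusion algebra, through its identification
with `A_{𝟙,𝟙}`. -/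
def sigmaSq : Set D.FusionAlgebra := {a | D.toTube a ∈ D.tubeCone}

end IrrChoice

section Sigma

variable {C : Type u} [Category.{v} C] [Preadditive C] [Linear ℂ C] [MonoidalCategory C]
  [CStarTensorCategory C]

/-- The morphism `(1_x ⊗ R̄†) (γ ⊗ 1_z̄)` from `z ⊗ z̄` to `x`, for `γ` from `z` to `x ⊗ z`. -/
def rotate {x z zbar : C} (Rbar : 𝟙_ C ⟶ z ⊗ zbar) (γ : z ⟶ x ⊗ z) : z ⊗ zbar ⟶ x :=
  γ ▷ zbar ≫ (α_ x z zbar).hom ≫ x ◁ Rbar† ≫ (ρ_ x).hom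

/-- The positive endomorphism `σ = (γ† ⊗ 1) (1_x ⊗ R̄ R̄†) (γ ⊗ 1)` of `z ⊗ z̄`. -/
def sigmaElt {x z zbar : C} (Rbar : 𝟙_ C ⟶ z ⊗ zbar) (γ : z ⟶ x ⊗ z) :
    z ⊗ zbar ⟶ z ⊗ zbar :=
  rotate Rbar γ ≫ (rotate Rbar γ)†

end Sigma

/-! Everything rests on one positive map. For an object `z` with conjugate `z̄`, send `σ ∈ End(z ⊗
z̄)` to `Psi (sandwich R σ)`, the image in the tube algebra of `(R† ⊗ 1)(1 ⊗ σ ⊗ 1)(1 ⊗ R)`. This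
map is linear, takes positive elements into the tube cone, and takes the identity to `d(z) 𝟙`.

Positivity: for `S : z ⊗ z̄ ⟶ y`, the sandwich of `S ≫ S†` is the composite of the two bent
morphisms `bendOut R S` and `bendIn R S`. `Psi` turns this composite into a tube product
(`tubeMul_Psi`), and its two factors are adjoint to each other (`tubeStar_Psi`). Splitting `y` into
simple objects gives a sum of elements `a a^*` (`Psi_sandwich_mem_tubeCone`). The value at the
identity comes from cyclicity of `Psi` (`Psi_cyclic`, `Psi_sandwich_id`).

Now `b^* b` is the image of the given `σ` (`tubeMul_tubeStar_Psi`), and `‖σ‖ 1 - σ` is positive,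
which proves the second claim. The third is the case `σ = R̄ R̄†`, of norm `d(z)`. For the first,
expand `(1 + r x)^* (1 + r x) ≥ 0` and bound `(r x)^* (r x)` by a multiple of `𝟙`; a self-adjoint
element is a finite sum of terms `r x + (r x)^*`. -/

/-! ### C*-categories and their endomorphism algebras -/

section CStarCategory

variable {C : Type u} [Category.{v} C] [Preadditive C] [Linear ℂ C] [CStarCategory C]

namespace CStarCategory

attribute [simp] dag_dag dag_id dag_comp dag_add dag_smul

@[simp] lemma dag_zero (X Y : C) : (0 : X ⟶ Y)† = 0 := by
  simpa using dag_smul (0 : ℂ) (0 : X ⟶ Y)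

/-- The involution as an additive homomorphism. -/
def dagHom (X Y : C) : (X ⟶ Y) →+ (Y ⟶ X) where
  toFun f := f†
  map_zero' := dag_zero X Y
  map_add' := dag_add

@[simp] lemma dag_sub {X Y : C} (f g : X ⟶ Y) : (f - g)† = f† - g† := map_sub (dagHom X Y) f g

lemma dag_sum {X Y : C} {ι : Type*} (s : Finset ι) (f : ι → (X ⟶ Y)) :
    (∑ i ∈ s, f i)† = ∑ i ∈ s, (f i)† := map_sum (dagHom X Y) f s

lemma eq_zero_of_comp_dag_eq_zero {X Y : C} {f : X ⟶ Y} (h : f ≫ f† = 0) : f = 0 := by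
  have h1 := cstar_identity f
  rw [h, (hnorm_eq_zero _).2 rfl] at h1
  exact (hnorm_eq_zero f).1 (by simpa using h1.symm)

lemma hnorm_dag_le {X Y : C} (f : X ⟶ Y) : hnorm f ≤ hnorm (f†) := by
  by_cases h : hnorm f = 0
  · rw [h]; exact hnorm_nonneg _
  · have h1 := hnorm_comp_le f (f†)
    rw [cstar_identity, sq] at h1
    exact le_of_mul_le_mul_left h1 ((hnorm_nonneg f).lt_of_ne' h)

@[simp] lemma hnorm_dag {X Y : C} (f : X ⟶ Y) : hnorm (f†) = hnorm f :=
  le_antisymm (by simpa using hnorm_dag_le (f†)) (hnorm_dag_le f)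

lemma hnorm_id_le (X : C) : hnorm (𝟙 X) ≤ 1 := by
  have h := cstar_identity (𝟙 X)
  simp only [dag_id, Category.comp_id] at h
  nlinarith [hnorm_nonneg (𝟙 X)]

lemma hnorm_id {X : C} (h : 𝟙 X ≠ 0) : hnorm (𝟙 X) = 1 := by
  have h1 := cstar_identity (𝟙 X)
  simp only [dag_id, Category.comp_id] at h1
  have h2 : hnorm (𝟙 X) ≠ 0 := fun h0 => h ((hnorm_eq_zero _).1 h0)
  have h3 : hnorm (𝟙 X) * (hnorm (𝟙 X) - 1) = 0 := by linarith
  rcases mul_eq_zero.1 h3 with h4 | h4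
  · exact absurd h4 h2
  · linarith

/-- The C*-algebra of endomorphisms of an object of a C*-category. -/
@[reducible] def endCStarAlgebra (X : C) : CStarAlgebra (End X) :=
  letI i1 : NormedAddCommGroup (End X) :=
    { (inferInstance : AddCommGroup (End X)) with
      norm := fun f => hnorm f
      dist := fun f g => hnorm (-f + g)
      dist_eq := fun _ _ => rfl
      dist_self := fun f => by
        rw [neg_add_cancel]; exact (hnorm_eq_zero _).2 rfl
      dist_comm := fun f g => by
        have h := hnorm_smul (-1 : ℂ) (-f + g : X ⟶ X)
        have h2 : ((-1 : ℂ) • (-f + g : X ⟶ X)) = -g + f := by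
          rw [neg_one_smul]; abel
        rw [h2] at h
        simpa using h.symm
      dist_triangle := fun f g h => by
        have h1 := hnorm_add_le (-f + g : X ⟶ X) (-g + h : X ⟶ X)
        have h2 : (-f + g : X ⟶ X) + (-g + h) = -f + h := by abel
        rwa [h2] at h1
      eq_of_dist_eq_zero := fun {f g} h => by
        have h1 := (hnorm_eq_zero _).1 h
        exact (neg_add_eq_zero.1 h1) }
  letI i2 : NormedRing (End X) :=
    { (inferInstance : Ring (End X)), i1 with
      -- The product `f * g` in `End X` is `g ≫ f`, so the factors trade places.
      norm_mul_le := fun f g => by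
        have h := hnorm_comp_le (g : X ⟶ X) (f : X ⟶ X)
        rw [mul_comm] at h
        exact h }
  letI i3 : StarRing (End X) :=
    { star := fun f => f†
      star_involutive := fun f => dag_dag f
      star_mul := fun f g => dag_comp g f
      star_add := fun f g => dag_add f g }
  { i2, i3 with
    algebraMap := (inferInstance : Algebra ℂ (End X)).algebraMap
    smul := (inferInstance : Algebra ℂ (End X)).smul
    commutes' := (inferInstance : Algebra ℂ (End X)).commutes'
    smul_def' := (inferInstance : Algebra ℂ (End X)).smul_def'
    norm_smul_le := fun c f => (hnorm_smul c f).le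
    star_smul := fun c f => dag_smul c f
    complete := by
      have hc : CompleteSpace (End X) := by
        refine Metric.complete_of_cauchySeq_tendsto fun s hs => ?_
        have hd : ∀ f g : End X, dist f g = hnorm (f - g : X ⟶ X) := fun f g => by
          rw [dist_comm]
          change hnorm (-g + f : X ⟶ X) = _
          rw [neg_add_eq_sub]
        obtain ⟨f, hf⟩ := complete (fun n => (s n : X ⟶ X)) fun ε hε => by
          obtain ⟨N, hN⟩ := Metric.cauchySeq_iff.1 hs ε hε
          exact ⟨N, fun m hm n hn => by rw [← hd]; exact hN m hm n hn⟩
        refine ⟨f, Metric.tendsto_atTop.2 fun ε hε => ?_⟩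
        obtain ⟨N, hN⟩ := hf ε hε
        exact ⟨N, fun n hn => by rw [hd]; exact hN n hn⟩
      exact fun {_} hf => hc.complete hf
    norm_mul_self_le := fun f => by
      have h := cstar_identity (f : X ⟶ X)
      rw [sq] at h
      exact h.ge }

open Polynomial in
lemma _root_.spectrum.finite_of_finiteDimensional {A : Type*} [Ring A] [Algebra ℂ A]
    [FiniteDimensional ℂ A] [Nontrivial A] (a : A) : (spectrum ℂ a).Finite := by
  obtain ⟨p, hm, hp⟩ := Algebra.IsIntegral.isIntegral (R := ℂ) a
  refine (p.rootSet_finite ℂ).subset fun c hc => ?_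
  have h := spectrum.subset_polynomial_aeval a p ⟨c, hc, rfl⟩
  rw [aeval_def, hp, spectrum.zero_eq] at h
  rw [mem_rootSet]
  exact ⟨hm.ne_zero, by simpa using h⟩

/-- A finite-dimensional C*-algebra without nontrivial projections consists of scalars. -/
lemma _root_.CStarAlgebra.exists_eq_smul_one_of_projections {A : Type*} [CStarAlgebra A]
    [FiniteDimensional ℂ A] [Nontrivial A]
    (hp : ∀ p : A, p * p = p → star p = p → p = 0 ∨ p = 1) (a : A) :
    ∃ c : ℂ, a = c • (1 : A) := by
  have key : ∀ a : A, IsSelfAdjoint a → ∃ c : ℂ, a = c • (1 : A) := by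
    intro a ha
    have hfin : (spectrum ℝ a).Finite := by
      rw [← spectrum.preimage_algebraMap ℂ]
      exact (spectrum.finite_of_finiteDimensional a).preimage
        (FaithfulSMul.algebraMap_injective ℝ ℂ).injOn
    obtain ⟨c, hc⟩ : (spectrum ℝ a).Nonempty :=
      ContinuousFunctionalCalculus.spectrum_nonempty a ha
    have hcont : ∀ f : ℝ → ℝ, ContinuousOn f (spectrum ℝ a) := fun f => hfin.continuousOn f
    -- The indicator of one spectral point is continuous on the finite spectrum and gives a
    -- projection. It is not `0` because `c` lies in the spectrum, so it is `1` and the spectrum is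
    -- `{c}`.
    let f : ℝ → ℝ := fun t => if t = c then 1 else 0
    have hff : cfc f a * cfc f a = cfc f a := by
      rw [← cfc_mul f f a (hcont _) (hcont _)]
      congr 1; ext t; by_cases h : t = c <;> simp [f, h]
    have hfs : star (cfc f a) = cfc f a := cfc_predicate f a
    rcases hp (cfc f a) hff hfs with h | h
    · rw [← cfc_const_zero ℝ a] at h
      have h1 := eqOn_of_cfc_eq_cfc h (hcont _) (hcont _) ha hc
      simp [f] at h1
    · rw [← cfc_const_one ℝ a] at h
      have h1 := eqOn_of_cfc_eq_cfc h (hcont _) (hcont _) ha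
      refine ⟨(c : ℂ), ?_⟩
      have h2 : a = cfc (fun _ => c) a := by
        conv_lhs => rw [← cfc_id ℝ a]
        refine cfc_congr fun t ht => ?_
        have := h1 ht
        by_contra h3
        have h4 : t ≠ c := h3
        simp [f, h4] at this
      rw [h2, cfc_const c a, Algebra.algebraMap_eq_smul_one]
      exact (Complex.coe_smul c (1 : A)).symm
  obtain ⟨c, hc⟩ := key (realPart a) (realPart a).2
  obtain ⟨d, hd⟩ := key (imaginaryPart a) (imaginaryPart a).2
  refine ⟨c + Complex.I * d, ?_⟩
  have h := realPart_add_I_smul_imaginaryPart a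
  rw [hc, hd, smul_smul, ← add_smul] at h
  exact h.symm

/-- A self-adjoint endomorphism is bounded by its norm. -/
lemma exists_norm_smul_sub_eq {X : C} (a : X ⟶ X) (ha : a† = a) :
    ∃ s : X ⟶ X, ((hnorm a : ℝ) : ℂ) • 𝟙 X - a = s ≫ s† := by
  let _ := endCStarAlgebra X
  let _ := CStarAlgebra.spectralOrder (End X)
  have := CStarAlgebra.spectralOrderedRing (End X)
  have h1 : IsSelfAdjoint (show End X from a) := ha
  have h2 := h1.le_algebraMap_norm_self
  rw [← sub_nonneg, CStarAlgebra.nonneg_iff_eq_star_mul_self] at h2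
  obtain ⟨b, hb⟩ := h2
  refine ⟨b, ?_⟩
  rw [Algebra.algebraMap_eq_smul_one, ← Complex.coe_smul] at hb
  exact hb

/-- An object with finite-dimensional endomorphism algebra and no nontrivial projection has only
scalar endomorphisms. -/
lemma exists_eq_smul_id_of_projections {X : C} [FiniteDimensional ℂ (X ⟶ X)]
    (hp : ∀ p : X ⟶ X, p ≫ p = p → p† = p → p = 0 ∨ p = 𝟙 X) (hX : 𝟙 X ≠ 0) (a : X ⟶ X) :
    ∃ c : ℂ, a = c • 𝟙 X := by
  let _ := endCStarAlgebra X
  have : FiniteDimensional ℂ (End X) := ‹FiniteDimensional ℂ (X ⟶ X)›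
  have : Nontrivial (End X) := ⟨1, 0, hX⟩
  exact CStarAlgebra.exists_eq_smul_one_of_projections (A := End X) hp a

end CStarCategory

end CStarCategory

lemma IsSimpleObj.smul_id_injective {C : Type u} [Category.{v} C] [Preadditive C] [Linear ℂ C]
    {X : C} (hX : IsSimpleObj X) {c d : ℂ}
    (h : c • 𝟙 X = d • 𝟙 X) : c = d := by
  by_contra hne
  rw [← sub_eq_zero, ← sub_smul, smul_eq_zero] at h
  exact h.elim (sub_ne_zero.2 hne) hX.1

/-! ### Orthonormal bases and finite-dimensionality of morphism spaces -/

section Tensor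

open CStarCategory CStarTensorCategory

variable {C : Type u} [Category.{v} C] [Preadditive C] [Linear ℂ C] [MonoidalCategory C]
  [CStarTensorCategory C]

namespace CStarTensorCategory

@[simp] lemma dag_whiskerLeft (X : C) {Y Z : C} (f : Y ⟶ Z) : (X ◁ f)† = X ◁ f† := by
  rw [← id_tensorHom, dag_tensor, dag_id, id_tensorHom]

@[simp] lemma dag_whiskerRight {Y Z : C} (f : Y ⟶ Z) (X : C) : (f ▷ X)† = f† ▷ X := by
  rw [← tensorHom_id, dag_tensor, dag_id, tensorHom_id]

attribute [simp] dag_associator dag_leftUnitor dag_rightUnitor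

@[simp] lemma dag_associator_inv (X Y Z : C) : ((α_ X Y Z).inv)† = (α_ X Y Z).hom := by
  rw [← dag_associator, dag_dag]

@[simp] lemma dag_leftUnitor_inv (X : C) : ((λ_ X).inv)† = (λ_ X).hom := by
  rw [← dag_leftUnitor, dag_dag]

lemma unitScalar_smul (f : 𝟙_ C ⟶ 𝟙_ C) : f = unitScalar f • 𝟙 (𝟙_ C) :=
  Classical.choose_spec ((unit_simple (C := C)).2 f)

@[simp] lemma unitScalar_smul_id (c : ℂ) : unitScalar (c • 𝟙 (𝟙_ C)) = c :=
  (unit_simple (C := C)).smul_id_injective (unitScalar_smul _).symm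

lemma unitScalar_add (f g : 𝟙_ C ⟶ 𝟙_ C) : unitScalar (f + g) = unitScalar f + unitScalar g := by
  apply (unit_simple (C := C)).smul_id_injective
  rw [add_smul, ← unitScalar_smul, ← unitScalar_smul, ← unitScalar_smul]

/-- A positive scalar endomorphism of a simple object is given by a nonnegative real. -/
lemma _root_.IsSimpleObj.exists_comp_dag_eq {w X : C} (hw : IsSimpleObj w) (f : w ⟶ X) :
    ∃ r : ℝ, 0 ≤ r ∧ f ≫ f† = (r : ℂ) • 𝟙 w := by
  obtain ⟨g, hg⟩ := dag_comp_self_positive f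
  obtain ⟨c, rfl⟩ := hw.2 g
  refine ⟨‖c‖ ^ 2, by positivity, ?_⟩
  rw [hg, dag_smul, dag_id, Linear.smul_comp, Linear.comp_smul, smul_smul, Category.comp_id,
    Complex.mul_conj, Complex.normSq_eq_norm_sq]

lemma unitScalar_comp_dag {X : C} (f : 𝟙_ C ⟶ X) :
    f ≫ f† = ((unitScalar (f ≫ f†)).re : ℂ) • 𝟙 (𝟙_ C) ∧ 0 ≤ (unitScalar (f ≫ f†)).re := by
  obtain ⟨r, hr, h⟩ := (unit_simple (C := C)).exists_comp_dag_eq f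
  rw [h, unitScalar_smul_id, Complex.ofReal_re]
  exact ⟨rfl, hr⟩

end CStarTensorCategory

section Onb

/-- Vectors of an orthonormal family of morphisms from `w` to `z`. -/
def IsOrthonormal {w z : C} (S : Set (w ⟶ z)) : Prop :=
  (∀ V ∈ S, V ≫ V† = 𝟙 w) ∧ (∀ V ∈ S, ∀ W ∈ S, V ≠ W → W ≫ V† = 0)

/-- Frobenius reciprocity in explicit form: bending the leg `z` up and back down is a zigzag. The
explicit formula yields both injectivity of the bending and a norm bound. -/
lemma ConjugateEquations.recover {z zbar : C} {R : 𝟙_ C ⟶ zbar ⊗ z} {Rbar : 𝟙_ C ⟶ z ⊗ zbar}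
    (h : ConjugateEquations R Rbar) {w : C} (f : z ⟶ w) :
    f = (ρ_ z).inv ≫ z ◁ (R ≫ zbar ◁ f) ≫ (α_ z zbar w).inv ≫ Rbar† ▷ w ≫ (λ_ w).hom := by
  have h2 := congrArg CStarCategory.dag h.2
  simp only [dag_comp, dag_id, dag_whiskerLeft, dag_whiskerRight, dag_associator, dag_dag,
    dag_leftUnitor_inv, dag_rightUnitor, Category.assoc] at h2
  rw [MonoidalCategory.whiskerLeft_comp]
  calc f = 𝟙 z ≫ f := by simp
    _ = _ := by
      rw [← h2]
      simp only [Category.assoc]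
      rw [← leftUnitor_naturality, ← whisker_exchange_assoc]
      simp

/-- Orthonormal families of morphisms from a simple object have bounded size. -/
lemma exists_card_le_of_isOrthonormal [IsRigid C] {w : C} (hw : IsSimpleObj w) (z : C) :
    ∃ N : ℕ, ∀ S : Finset (w ⟶ z), IsOrthonormal (S : Set (w ⟶ z)) → S.card ≤ N := by
  classical
  obtain ⟨zbar, R, Rbar, hR⟩ := IsRigid.exists_conjugate z
  -- A positive functional on `End(z)`. By `low` it is bounded below by `K⁻²` on each projection `V†
  -- ≫ V`, while orthogonality bounds the sum of its values on these by `E (𝟙 z)`; hence the bound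
  -- on the cardinality.
  let E : (z ⟶ z) → ℝ := fun f => (unitScalar (R ≫ zbar ◁ f ≫ R†)).re
  have Eadd : ∀ f g, E (f + g) = E f + E g := fun f g => by
    simp only [E]
    rw [MonoidalPreadditive.whiskerLeft_add, Preadditive.add_comp, Preadditive.comp_add,
      unitScalar_add, Complex.add_re]
  have Epos : ∀ {y : C} (f : z ⟶ y), R ≫ zbar ◁ (f ≫ f†) ≫ R† = ((E (f ≫ f†) : ℝ) : ℂ) • 𝟙 _ ∧
      0 ≤ E (f ≫ f†) := fun {y} f => by
    have h := unitScalar_comp_dag (R ≫ zbar ◁ f)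
    have h2 : (R ≫ zbar ◁ f) ≫ (R ≫ zbar ◁ f)† = R ≫ zbar ◁ (f ≫ f†) ≫ R† := by simp
    rw [h2] at h
    exact h
  let K : ℝ := hnorm (ρ_ z).inv * hnorm ((α_ z zbar w).inv ≫ Rbar† ▷ w ≫ (λ_ w).hom)
  have hK : 0 ≤ K := mul_nonneg (hnorm_nonneg _) (hnorm_nonneg _)
  have low : ∀ V : w ⟶ z, V ≫ V† = 𝟙 w → 1 ≤ K ^ 2 * E (V† ≫ V) := fun V hV => by
    have h1 : hnorm (V†) = 1 := by
      have h := cstar_identity V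
      rw [hV, hnorm_id hw.1] at h
      rw [hnorm_dag]
      have := hnorm_nonneg V
      nlinarith
    obtain ⟨h2, h3⟩ := Epos (V†)
    rw [dag_dag] at h2 h3
    have h4 : hnorm (z ◁ (R ≫ zbar ◁ V†)) ^ 2 ≤ E (V† ≫ V) := by
      rw [← cstar_identity]
      have h5 : z ◁ (R ≫ zbar ◁ V†) ≫ (z ◁ (R ≫ zbar ◁ V†))† =
          ((E (V† ≫ V) : ℝ) : ℂ) • 𝟙 _ := by
        rw [dag_whiskerLeft, ← MonoidalCategory.whiskerLeft_comp]
        simp only [dag_comp, dag_whiskerLeft, dag_dag, Category.assoc]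
        rw [← MonoidalCategory.whiskerLeft_comp_assoc, h2, MonoidalLinear.whiskerLeft_smul,
          whiskerLeft_id]
      rw [h5, hnorm_smul, Complex.norm_real, Real.norm_of_nonneg h3]
      exact mul_le_of_le_one_right h3 (hnorm_id_le _)
    -- `V†` is rebuilt from its bent form by composing with fixed morphisms, whose norms make up
    -- `K`.
    have h6 : hnorm (V†) ≤ K * hnorm (z ◁ (R ≫ zbar ◁ V†)) := by
      conv_lhs => rw [hR.recover (V†)]
      refine (hnorm_comp_le _ _).trans ?_
      refine (mul_le_mul_of_nonneg_left (hnorm_comp_le _ _) (hnorm_nonneg _)).trans_eq ?_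
      simp only [K]; ring
    rw [h1] at h6
    have h7 : (1 : ℝ) ≤ (K * hnorm (z ◁ (R ≫ zbar ◁ V†))) ^ 2 := by nlinarith
    rw [mul_pow] at h7
    exact h7.trans (mul_le_mul_of_nonneg_left h4 (sq_nonneg _))
  refine ⟨⌈K ^ 2 * E (𝟙 z)⌉₊, fun S hS => ?_⟩
  have h1 : E (∑ V ∈ S, V† ≫ V) = ∑ V ∈ S, E (V† ≫ V) :=
    map_sum (AddMonoidHom.mk' E Eadd) _ _
  set p : z ⟶ z := ∑ V ∈ S, V† ≫ V with hp
  have hpd : p† = p := by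
    rw [hp, dag_sum]; simp
  have hpp : p ≫ p = p := by
    rw [hp, Preadditive.sum_comp]
    refine Finset.sum_congr rfl fun V hV => ?_
    rw [Category.assoc, Preadditive.comp_sum, Finset.sum_eq_single V]
    · rw [← Category.assoc V, hS.1 V hV, Category.id_comp]
    · intro W hW hne
      rw [← Category.assoc, hS.2 W hW V hV hne, Limits.zero_comp]
    · exact fun h => absurd hV h
  have hq : 𝟙 z - p = (𝟙 z - p) ≫ (𝟙 z - p)† := by
    rw [dag_sub, dag_id, hpd, Preadditive.sub_comp, Preadditive.comp_sub, Preadditive.comp_sub,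
      hpp]
    simp
  have h2 : E (𝟙 z) = E (𝟙 z - p) + E p := by rw [← Eadd]; simp
  have h3 : 0 ≤ E (𝟙 z - p) := by rw [hq]; exact (Epos _).2
  have h4 : (S.card : ℝ) ≤ K ^ 2 * E p := by
    rw [h1, Finset.mul_sum, Finset.card_eq_sum_ones, Nat.cast_sum]
    refine Finset.sum_le_sum fun V hV => ?_
    simpa using low V (hS.1 V hV)
  have h5 : (S.card : ℝ) ≤ K ^ 2 * E (𝟙 z) := by
    rw [h2]; nlinarith [sq_nonneg K]
  exact_mod_cast h5.trans (Nat.le_ceil _)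

lemma IsOrthonormal.finite [IsRigid C] {w z : C} (hw : IsSimpleObj w) {S : Set (w ⟶ z)}
    (hS : IsOrthonormal S) : S.Finite := by
  obtain ⟨N, hN⟩ := exists_card_le_of_isOrthonormal hw z
  by_contra h
  obtain ⟨T, hT, hc⟩ := Set.Infinite.exists_subset_card_eq (s := S) h (N + 1)
  have := hN T ⟨fun V hV => hS.1 V (hT hV), fun V hV W hW => hS.2 V (hT hV) W (hT hW)⟩
  omega

/-- The projection onto the span of an orthonormal family acts as the identity on this span. -/
lemma IsOrthonormal.comp_sum {w z : C} {S : Finset (w ⟶ z)}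
    (hS : IsOrthonormal (S : Set (w ⟶ z))) {f : w ⟶ z}
    (hf : f ∈ Submodule.span ℂ (S : Set (w ⟶ z))) : ∑ V ∈ S, f ≫ V† ≫ V = f := by
  classical
  induction hf using Submodule.span_induction with
  | mem W hW =>
    rw [Finset.sum_eq_single W]
    · rw [← Category.assoc, hS.1 W hW, Category.id_comp]
    · intro V hV hne
      rw [← Category.assoc, hS.2 V hV W hW hne, Limits.zero_comp]
    · exact fun h => absurd hW h
  | zero => simp
  | add f g _ _ hf hg => simp only [Preadditive.add_comp, Finset.sum_add_distrib, hf, hg]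
  | smul c f _ hf => simp only [Linear.smul_comp, ← Finset.smul_sum, hf]

/-- An orthonormal family of maximal size spans: otherwise a Gram–Schmidt step would enlarge it. No
finite-dimensionality is presupposed; it is deduced from this afterwards. -/
lemma exists_isOnb [IsRigid C] {w : C} (hw : IsSimpleObj w) (z : C) :
    ∃ S : Set (w ⟶ z), IsOnb S := by
  classical
  obtain ⟨N, hN⟩ := exists_card_le_of_isOrthonormal hw z
  let P : ℕ → Prop := fun n => ∃ S : Finset (w ⟶ z), IsOrthonormal (S : Set (w ⟶ z)) ∧ S.card = n
  have hP0 : P 0 := ⟨∅, ⟨by simp, by simp⟩, rfl⟩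
  obtain ⟨S, hS, hc⟩ : P (Nat.findGreatest P N) := Nat.findGreatest_spec (Nat.zero_le N) hP0
  refine ⟨S, hS.1, hS.2, ?_⟩
  rw [eq_top_iff]
  intro f _
  set g : w ⟶ z := f - ∑ V ∈ S, f ≫ V† ≫ V with hg
  have hsum : ∑ V ∈ S, f ≫ V† ≫ V ∈ Submodule.span ℂ (S : Set (w ⟶ z)) := by
    refine Submodule.sum_mem _ fun V hV => ?_
    obtain ⟨c, hc⟩ := hw.2 (f ≫ V†)
    rw [← Category.assoc, hc, Linear.smul_comp, Category.id_comp]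
    exact Submodule.smul_mem _ _ (Submodule.subset_span hV)
  have horth : ∀ W ∈ S, g ≫ W† = 0 := fun W hW => by
    rw [hg, Preadditive.sub_comp, Preadditive.sum_comp, Finset.sum_eq_single W]
    · rw [Category.assoc, Category.assoc, hS.1 W hW, Category.comp_id, sub_self]
    · intro V hV hne
      rw [Category.assoc, Category.assoc, hS.2 W hW V hV hne.symm, Limits.comp_zero,
        Limits.comp_zero]
    · exact fun h => absurd hW h
  by_cases hg0 : g = 0
  · rw [hg, sub_eq_zero] at hg0
    rw [hg0]; exact hsum
  exfalso
  obtain ⟨r, hr, hgr⟩ := hw.exists_comp_dag_eq g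
  have hr0 : r ≠ 0 := fun h => hg0 (eq_zero_of_comp_dag_eq_zero (by rw [hgr, h]; simp))
  set c : ℂ := (((Real.sqrt r)⁻¹ : ℝ) : ℂ) with hcdef
  have hcc : c * c * r = 1 := by
    rw [hcdef, ← Complex.ofReal_mul, ← Complex.ofReal_mul, ← mul_inv, Real.mul_self_sqrt hr,
      inv_mul_cancel₀ hr0, Complex.ofReal_one]
  have hstar : (starRingEnd ℂ) c = c := Complex.conj_ofReal _
  have hnormed : (c • g) ≫ (c • g)† = 𝟙 w := by
    rw [dag_smul, hstar, Linear.smul_comp, Linear.comp_smul, hgr, smul_smul, smul_smul, hcc,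
      one_smul]
  have h0 : ∀ W ∈ S, (c • g) ≫ W† = 0 := fun W hW => by
    rw [Linear.smul_comp, horth W hW, smul_zero]
  have h0' : ∀ W ∈ S, W ≫ (c • g)† = 0 := fun W hW => by
    have := congrArg CStarCategory.dag (h0 W hW)
    rwa [dag_comp, dag_dag, dag_zero] at this
  have hnot : c • g ∉ S := fun h => hw.1 (by rw [← hnormed]; exact h0 _ h)
  have hins : IsOrthonormal ((insert (c • g) S : Finset (w ⟶ z)) : Set (w ⟶ z)) := by
    constructor
    · intro V hV
      rcases Finset.mem_insert.1 hV with rfl | hV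
      · exact hnormed
      · exact hS.1 V hV
    · intro V hV W hW hne
      rcases Finset.mem_insert.1 hV with rfl | hV <;> rcases Finset.mem_insert.1 hW with rfl | hW
      · exact absurd rfl hne
      · exact h0' W hW
      · exact h0 V hV
      · exact hS.2 V hV W hW hne
  have hcard := Finset.card_insert_of_notMem hnot
  have hle := hN _ hins
  have := Nat.le_findGreatest (P := P) hle ⟨_, hins, rfl⟩
  omega

lemma isOnb_onb [IsRigid C] {w : C} (hw : IsSimpleObj w) (z : C) : IsOnb (onb w z) :=
  Classical.epsilon_spec (exists_isOnb hw z)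

lemma IsOnb.isOrthonormal {w z : C} {S : Set (w ⟶ z)} (hS : IsOnb S) : IsOrthonormal S :=
  ⟨hS.1, hS.2.1⟩

open Classical in
/-- The chosen orthonormal basis as a finset (empty when it is infinite, which does not happen for
simple `w`). -/
noncomputable def onbFinset (w z : C) : Finset (w ⟶ z) :=
  if h : (onb w z).Finite then h.toFinset else ∅

lemma coe_onbFinset [IsRigid C] {w : C} (hw : IsSimpleObj w) (z : C) :
    (onbFinset w z : Set (w ⟶ z)) = onb w z := by
  have h := (isOnb_onb hw z).isOrthonormal.finite hw
  rw [onbFinset, dif_pos h, Set.Finite.coe_toFinset]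

lemma isOrthonormal_onbFinset [IsRigid C] {w : C} (hw : IsSimpleObj w) (z : C) :
    IsOrthonormal (onbFinset w z : Set (w ⟶ z)) := by
  rw [coe_onbFinset hw]; exact (isOnb_onb hw z).isOrthonormal

lemma finsum_mem_onb [IsRigid C] {w : C} (hw : IsSimpleObj w) (z : C) {M : Type*}
    [AddCommMonoid M] (f : (w ⟶ z) → M) :
    ∑ᶠ (V : w ⟶ z) (_ : V ∈ onb w z), f V = ∑ V ∈ onbFinset w z, f V := by
  rw [← coe_onbFinset hw, finsum_mem_coe_finset]

lemma sum_onbFinset [IsRigid C] {w z : C} (hw : IsSimpleObj w) (f : w ⟶ z) :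
    ∑ V ∈ onbFinset w z, f ≫ V† ≫ V = f :=
  (isOrthonormal_onbFinset hw z).comp_sum (by
    rw [coe_onbFinset hw, (isOnb_onb hw z).2.2]; trivial)

instance finiteDimensional_hom_unit [IsRigid C] (z : C) : FiniteDimensional ℂ (𝟙_ C ⟶ z) := by
  refine ⟨⟨onbFinset (𝟙_ C) z, ?_⟩⟩
  rw [coe_onbFinset unit_simple]
  exact (isOnb_onb unit_simple z).2.2

instance finiteDimensional_hom [IsRigid C] (y z : C) : FiniteDimensional ℂ (y ⟶ z) := by
  obtain ⟨ybar, R, Rbar, hR⟩ := IsRigid.exists_conjugate y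
  let F : (y ⟶ z) →ₗ[ℂ] (𝟙_ C ⟶ ybar ⊗ z) :=
    { toFun := fun f => R ≫ ybar ◁ f
      map_add' := fun f g => by rw [MonoidalPreadditive.whiskerLeft_add, Preadditive.comp_add]
      map_smul' := fun c f => by
        rw [MonoidalLinear.whiskerLeft_smul, Linear.comp_smul, RingHom.id_apply] }
  refine FiniteDimensional.of_injective F fun f g h => ?_
  have h' : R ≫ ybar ◁ f = R ≫ ybar ◁ g := h
  rw [hR.recover f, hR.recover g, h']

end Onb

end Tensor

/-! ### Schur's lemma and dual frames -/

section Frame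

open CStarCategory

variable {C : Type u} [Category.{v} C] [Preadditive C] [Linear ℂ C] [CStarCategory C]

/-- A nonzero morphism between simple objects is a multiple of a unitary. -/
lemma IsSimpleObj.nonempty_iso_of_ne_zero {w w' : C} (hw : IsSimpleObj w) (hw' : IsSimpleObj w')
    {f : w ⟶ w'} (hf : f ≠ 0) : Nonempty (w ≅ w') := by
  obtain ⟨c, hc⟩ := hw.2 (f ≫ f†)
  obtain ⟨d, hd⟩ := hw'.2 (f† ≫ f)
  have hc0 : c ≠ 0 := fun h => hf (eq_zero_of_comp_dag_eq_zero (by rw [hc, h, zero_smul]))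
  have hcd : c • f = d • f := by
    calc c • f = (f ≫ f†) ≫ f := by rw [hc, Linear.smul_comp, Category.id_comp]
      _ = d • f := by rw [Category.assoc, hd, Linear.comp_smul, Category.comp_id]
  have hcd' : c = d := by
    by_contra hne
    rw [← sub_eq_zero, ← sub_smul, smul_eq_zero] at hcd
    exact hcd.elim (sub_ne_zero.2 hne) hf
  refine ⟨⟨f, c⁻¹ • f†, ?_, ?_⟩⟩
  · rw [Linear.comp_smul, hc, smul_smul, inv_mul_cancel₀ hc0, one_smul]
  · rw [Linear.smul_comp, hd, ← hcd', smul_smul, inv_mul_cancel₀ hc0, one_smul]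

/-- Two finite families of morphisms from `w` to `z` that are dual to each other: every morphism
has an expansion in `u` with coefficients given by the inner products with `u'`. -/
def IsDualFrame {w z : C} {ι : Type*} (s : Finset ι) (u u' : ι → (w ⟶ z)) : Prop :=
  ∀ f : w ⟶ z, ∑ i ∈ s, f ≫ (u' i)† ≫ u i = f

/-- The defect `g` of the reversed expansion is orthogonal to every morphism `w ⟶ z`, itself
included, so the C*-identity makes it vanish. -/
lemma IsDualFrame.symm {w z : C} {ι : Type*} {s : Finset ι} {u u' : ι → (w ⟶ z)}
    (h : IsDualFrame s u u') : IsDualFrame s u' u := by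
  intro f
  rw [← sub_eq_zero]
  set g := ∑ i ∈ s, f ≫ (u i)† ≫ u' i - f with hg
  have key : ∀ k : w ⟶ z, k ≫ g† = 0 := fun k => by
    rw [hg, dag_sub, dag_sum, Preadditive.comp_sub, Preadditive.comp_sum]
    conv_lhs => rw [← h k]
    simp only [dag_comp, dag_dag, Category.assoc, Preadditive.sum_comp]
    rw [sub_eq_zero]
    conv_rhs => rw [← h k]
    simp [Preadditive.sum_comp]
  exact eq_zero_of_comp_dag_eq_zero (key g)

lemma IsDualFrame.dag {w z : C} {ι : Type*} {s : Finset ι} {u u' : ι → (w ⟶ z)}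
    (h : IsDualFrame s u u') (f : z ⟶ w) : ∑ i ∈ s, (u i)† ≫ u' i ≫ f = f := by
  have h1 := congrArg CStarCategory.dag (h (f†))
  rw [dag_sum, dag_dag] at h1
  simpa using h1

end Frame

/-! ### Cyclicity of `Psi` and decomposition into simple objects -/

section Tensor

open CStarCategory CStarTensorCategory

variable {C : Type u} [Category.{v} C] [Preadditive C] [Linear ℂ C] [MonoidalCategory C]
  [CStarTensorCategory C]

/-- The sum of `u i ⊗ (u i)†` over a dual frame does not depend on the frame and is cyclic. -/
lemma IsDualFrame.sum_cyclic {w z z' x y : C} (hw : IsSimpleObj w) {ι κ : Type*} {s : Finset ι}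
    {t : Finset κ} {u u' : ι → (w ⟶ z)} {v v' : κ → (w ⟶ z')} (hu : IsDualFrame s u u')
    (hv : IsDualFrame t v v') (T : z ⟶ z') (g : z' ⊗ x ⟶ y ⊗ z) :
    ∑ i ∈ s, (u i ≫ T) ▷ x ≫ g ≫ y ◁ (u' i)† = ∑ j ∈ t, v j ▷ x ≫ g ≫ y ◁ (T ≫ (v' j)†) := by
  -- Since `w` is simple, `T` acts by a scalar matrix between the two frames; both sides are the
  -- same double sum over its entries.
  choose c hc using fun i j => hw.2 (u i ≫ T ≫ (v' j)†)
  have h1 : ∀ i, u i ≫ T = ∑ j ∈ t, c i j • v j := fun i => by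
    conv_lhs => rw [← hv (u i ≫ T)]
    refine Finset.sum_congr rfl fun j _ => ?_
    have h := hc i j
    rw [← Category.assoc] at h
    rw [← Category.assoc _ ((v' j)†), h, Linear.smul_comp, Category.id_comp]
  have h2 : ∀ j, T ≫ (v' j)† = ∑ i ∈ s, c i j • (u' i)† := fun j => by
    conv_lhs => rw [← hu.symm.dag (T ≫ (v' j)†)]
    refine Finset.sum_congr rfl fun i _ => ?_
    rw [hc, Linear.comp_smul, Category.comp_id]
  simp only [h1, h2, sum_whiskerRight, whiskerLeft_sum, Preadditive.sum_comp, Preadditive.comp_sum,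
    MonoidalLinear.smul_whiskerRight, MonoidalLinear.whiskerLeft_smul, Linear.smul_comp,
    Linear.comp_smul]
  exact Finset.sum_comm

lemma IsDualFrame.onb [IsRigid C] {w : C} (hw : IsSimpleObj w) (z : C) :
    IsDualFrame (onbFinset w z) (fun V => V) (fun V => V) :=
  fun f => sum_onbFinset hw f

/-- Every nonzero object receives a nonzero morphism from a simple object. -/
lemma exists_simple_hom_ne_zero [IsRigid C] (z : C) (hz : 𝟙 z ≠ 0) :
    ∃ (w : C) (f : w ⟶ z), IsSimpleObj w ∧ f ≠ 0 := by
  induction hn : Module.finrank ℂ (z ⟶ z) using Nat.strong_induction_on generalizing z with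
  | _ n ih =>
    by_cases hp : ∀ p : z ⟶ z, p ≫ p = p → p† = p → p = 0 ∨ p = 𝟙 z
    · exact ⟨z, 𝟙 z, ⟨hz, exists_eq_smul_id_of_projections hp hz⟩, hz⟩
    push Not at hp
    obtain ⟨p, hpp, hpd, hp0, hp1⟩ := hp
    obtain ⟨y, i, hi, hip⟩ := exists_subobject z p hpp hpd
    -- The isometry `i` embeds `End(y)` into `End(z)`. The image misses `𝟙 z` because `p ≠ 𝟙 z`, so
    -- the dimension drops and induction applies.
    let F : (y ⟶ y) →ₗ[ℂ] (z ⟶ z) :=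
      { toFun := fun f => i† ≫ f ≫ i
        map_add' := fun f g => by simp
        map_smul' := fun c f => by simp }
    have hFinj : Function.Injective F := fun f g h => by
      have h' : i† ≫ f ≫ i = i† ≫ g ≫ i := h
      have h2 : ∀ f : y ⟶ y, f = i ≫ (i† ≫ f ≫ i) ≫ i† := fun f => by
        simp only [Category.assoc, hi, Category.comp_id]
        rw [← Category.assoc, hi, Category.id_comp]
      rw [h2 f, h', ← h2 g]
    have hlt : Module.finrank ℂ (y ⟶ y) < n := by
      rw [← hn, ← LinearMap.finrank_range_of_inj hFinj]
      apply Submodule.finrank_lt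
      intro htop
      have h1 : 𝟙 z ∈ LinearMap.range F := by rw [htop]; trivial
      obtain ⟨f, hf⟩ := h1
      have hf' : i† ≫ f ≫ i = 𝟙 z := hf
      apply hp1
      calc p = p ≫ (i† ≫ f ≫ i) := by rw [hf', Category.comp_id]
        _ = i† ≫ (i ≫ i†) ≫ f ≫ i := by rw [← hip]; simp only [Category.assoc]
        _ = 𝟙 z := by rw [hi, Category.id_comp, hf']
    have hy : 𝟙 y ≠ 0 := fun h => hp0 (by
      rw [← hip, ← Category.id_comp i, h, Limits.zero_comp, Limits.comp_zero])
    obtain ⟨w, f, hw, hf⟩ := ih _ hlt y hy rfl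
    refine ⟨w, f ≫ i, hw, fun h => hf ?_⟩
    rw [← Category.comp_id f, ← hi, ← Category.assoc, h, Limits.zero_comp]

namespace IrrChoice

variable (D : IrrChoice C)

lemma hom_eq_zero {w w' : D.Irr} (h : w ≠ w') (f : (w : C) ⟶ w') : f = 0 := by
  by_contra hf
  exact h (Subtype.ext (D.eq_of_iso _ w.2 _ w'.2
    ((D.simple _ w.2).nonempty_iso_of_ne_zero (D.simple _ w'.2) hf)))

/-- The simple objects occurring in `z`. -/
def supp (z : C) : Set D.Irr := {w | ∃ f : (w : C) ⟶ z, f ≠ 0}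

variable [IsRigid C]

lemma onbFinset_eq_empty {w : D.Irr} {z : C} (h : w ∉ D.supp z) : onbFinset (w : C) z = ∅ := by
  rw [Finset.eq_empty_iff_forall_notMem]
  intro V hV
  refine h ⟨V, fun h0 => (D.simple _ w.2).1 ?_⟩
  rw [← (isOrthonormal_onbFinset (D.simple _ w.2) z).1 V hV, h0, Limits.zero_comp]

lemma supp_finite (z : C) : (D.supp z).Finite := by
  classical
  -- These nonzero, mutually orthogonal projections are linearly independent in the
  -- finite-dimensional `End(z)`, so only finitely many occur.
  let e : (Σ w : D.Irr, ↥(onbFinset (w : C) z)) → (z ⟶ z) := fun i => (i.2 : (i.1 : C) ⟶ z)† ≫ i.2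
  have horth : ∀ i j, i ≠ j → e i ≫ e j = 0 := by
    rintro ⟨w, V, hV⟩ ⟨w', W, hW⟩ hne
    have h0 : V ≫ W† = 0 := by
      by_cases hww : w = w'
      · subst hww
        refine (isOrthonormal_onbFinset (D.simple _ w.2) z).2 W hW V hV fun h => hne ?_
        subst h; rfl
      · exact D.hom_eq_zero hww _
    simp only [e, Category.assoc]
    rw [← Category.assoc V, h0, Limits.zero_comp, Limits.comp_zero]
  have hne : ∀ i, e i ≫ e i ≠ 0 := by
    rintro ⟨w, V, hV⟩ h
    have h1 := (isOrthonormal_onbFinset (D.simple _ w.2) z).1 V hV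
    apply (D.simple _ w.2).1
    calc 𝟙 (w : C) = (V ≫ V†) ≫ (V ≫ V†) ≫ V ≫ V† := by simp only [h1, Category.comp_id]
      _ = V ≫ ((V† ≫ V) ≫ V† ≫ V) ≫ V† := by simp only [Category.assoc]
      _ = 0 := by
        have h2 : (V† ≫ V) ≫ V† ≫ V = 0 := h
        rw [h2, Limits.zero_comp, Limits.comp_zero]
  have hli : LinearIndependent ℂ e := by
    rw [linearIndependent_iff']
    intro s c hc i hi
    have h1 : (∑ j ∈ s, c j • e j) ≫ e i = 0 := by rw [hc, Limits.zero_comp]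
    rw [Preadditive.sum_comp, Finset.sum_eq_single i, Linear.smul_comp, smul_eq_zero] at h1
    · exact h1.resolve_right (hne i)
    · intro j _ hj
      rw [Linear.smul_comp, horth j i hj, smul_zero]
    · exact fun h => absurd hi h
  have hfin : Finite (Σ w : D.Irr, ↥(onbFinset (w : C) z)) := hli.finite
  refine (Set.finite_range (fun i : (Σ w : D.Irr, ↥(onbFinset (w : C) z)) => i.1)).subset ?_
  rintro w ⟨f, hf⟩
  have hnonempty : (onbFinset (w : C) z).Nonempty := by
    by_contra h
    rw [Finset.not_nonempty_iff_eq_empty] at h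
    have h1 := sum_onbFinset (D.simple _ w.2) f
    rw [h, Finset.sum_empty] at h1
    exact hf h1.symm
  obtain ⟨V, hV⟩ := hnonempty
  exact ⟨⟨w, V, hV⟩, rfl⟩

/-- The simple objects occurring in `z`, as a finset. -/
noncomputable def suppFinset (z : C) : Finset D.Irr := (D.supp_finite z).toFinset

lemma onbFinset_eq_empty' {w : D.Irr} {z : C} (h : w ∉ D.suppFinset z) :
    onbFinset (w : C) z = ∅ :=
  D.onbFinset_eq_empty fun h' => h ((D.supp_finite z).mem_toFinset.2 h')

/-- Every object is the orthogonal direct sum of simple objects. -/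
lemma sum_suppFinset (z : C) :
    ∑ w ∈ D.suppFinset z, ∑ V ∈ onbFinset (w : C) z, V† ≫ V = 𝟙 z := by
  classical
  set p : z ⟶ z := ∑ w ∈ D.suppFinset z, ∑ V ∈ onbFinset (w : C) z, V† ≫ V with hp
  have hf : ∀ (w : D.Irr) (f : (w : C) ⟶ z), f ≫ p = f := by
    intro w f
    rw [hp, Preadditive.comp_sum, Finset.sum_eq_single w]
    · rw [Preadditive.comp_sum]
      exact sum_onbFinset (D.simple _ w.2) f
    · intro w' _ hne
      rw [Preadditive.comp_sum]
      refine Finset.sum_eq_zero fun V _ => ?_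
      rw [← Category.assoc, D.hom_eq_zero hne.symm (f ≫ V†), Limits.zero_comp]
    · intro hw
      rw [D.onbFinset_eq_empty' hw, Finset.sum_empty, Limits.comp_zero]
  have hpd : p† = p := by
    rw [hp, dag_sum]
    refine Finset.sum_congr rfl fun w _ => ?_
    rw [dag_sum]; simp
  have hpp : p ≫ p = p := by
    conv_lhs => rw [hp]
    simp only [Preadditive.sum_comp, Category.assoc]
    rw [hp]
    refine Finset.sum_congr rfl fun w _ => Finset.sum_congr rfl fun V _ => ?_
    rw [← hp, hf]
  by_contra hne
  -- A nonzero complement of `p` would receive a nonzero morphism from some simple object, but `p`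
  -- fixes all such morphisms to `z`.
  obtain ⟨y, i, hi, hip⟩ := exists_subobject z (𝟙 z - p) (by simp [hpp]) (by simp [hpd])
  have hy : 𝟙 y ≠ 0 := fun h => hne (by
    have h1 : 𝟙 z - p = 0 := by
      rw [← hip, ← Category.id_comp i, h, Limits.zero_comp, Limits.comp_zero]
    exact (sub_eq_zero.1 h1).symm)
  obtain ⟨w, f, hw, hf0⟩ := exists_simple_hom_ne_zero y hy
  obtain ⟨w', hw', ⟨e⟩⟩ := D.exists_iso w hw
  have h1 := hf ⟨w', hw'⟩ (e.inv ≫ f ≫ i)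
  have h2 : i ≫ (𝟙 z - p) = i := by
    rw [← hip, ← Category.assoc, hi, Category.id_comp]
  have h3 : i ≫ p = 0 := by
    rw [Preadditive.comp_sub, Category.comp_id, sub_eq_self] at h2
    exact h2
  simp only [Category.assoc, h3, Limits.comp_zero] at h1
  apply hf0
  calc f = e.hom ≫ (e.inv ≫ f ≫ i) ≫ i† := by simp [hi]
    _ = 0 := by rw [← h1]; simp

/-- The components of `Psi γ` can be computed with any dual frame. -/
lemma Psi_apply {x y z : C} (g : z ⊗ x ⟶ y ⊗ z) (w : D.Irr) {ι : Type*} {s : Finset ι}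
    {u u' : ι → ((w : C) ⟶ z)} (hu : IsDualFrame s u u') :
    D.Psi g w = ∑ i ∈ s, u i ▷ x ≫ g ≫ y ◁ (u' i)† := by
  have hw := D.simple _ w.2
  have h := (IsDualFrame.onb hw z).sum_cyclic hw hu (𝟙 z) g
  simp only [Category.comp_id, Category.id_comp] at h
  rw [← h, Psi, finsum_mem_onb hw]

lemma Psi_apply_onb {x y z : C} (g : z ⊗ x ⟶ y ⊗ z) (w : D.Irr) :
    D.Psi g w = ∑ V ∈ onbFinset (w : C) z, V ▷ x ≫ g ≫ y ◁ V† :=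
  D.Psi_apply g w (IsDualFrame.onb (D.simple _ w.2) z)

/-- The trace property of `Psi`. It allows the object being summed over to be changed, in particular
from `z̄ ⊗ z` to the unit. -/
lemma Psi_cyclic {x y z z' : C} (T : z ⟶ z') (g : z' ⊗ x ⟶ y ⊗ z) :
    D.Psi (T ▷ x ≫ g) = D.Psi (g ≫ y ◁ T) := by
  funext w
  have hw := D.simple _ w.2
  rw [Psi_apply_onb, Psi_apply_onb]
  simpa using (IsDualFrame.onb hw z).sum_cyclic hw (IsDualFrame.onb hw z') T g

lemma Psi_mem_tube {x y z : C} (g : z ⊗ x ⟶ y ⊗ z) : D.Psi g ∈ D.tube x y := by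
  refine (D.supp_finite z).subset fun w hw => ?_
  by_contra h
  apply hw
  rw [Psi_apply_onb, D.onbFinset_eq_empty h, Finset.sum_empty]

lemma Psi_add {x y z : C} (g h : z ⊗ x ⟶ y ⊗ z) : D.Psi (g + h) = D.Psi g + D.Psi h := by
  funext w
  simp only [Psi_apply_onb, Pi.add_apply, Preadditive.add_comp, Preadditive.comp_add,
    Finset.sum_add_distrib]

lemma Psi_smul {x y z : C} (c : ℂ) (g : z ⊗ x ⟶ y ⊗ z) : D.Psi (c • g) = c • D.Psi g := by
  funext w
  simp only [Psi_apply_onb, Pi.smul_apply, Linear.smul_comp, Linear.comp_smul, Finset.smul_sum]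

lemma Psi_sum {x y z : C} {ι : Type*} (s : Finset ι) (g : ι → (z ⊗ x ⟶ y ⊗ z)) :
    D.Psi (∑ i ∈ s, g i) = ∑ i ∈ s, D.Psi (g i) :=
  map_sum (AddMonoidHom.mk' D.Psi D.Psi_add) _ _

end IrrChoice

end Tensor

/-! ### `Psi` turns composition into the tube product -/

section Monoidal

variable {C : Type u} [Category.{v} C] [MonoidalCategory C]

/-- The composite of `h : z' ⊗ i ⟶ s ⊗ z'` and `g : z ⊗ s ⟶ j ⊗ z`, which is mapped by `Psi` to the
product in the tube algebra. -/
def tubeComp {z z' i s j : C} (g : z ⊗ s ⟶ j ⊗ z) (h : z' ⊗ i ⟶ s ⊗ z') :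
    (z ⊗ z') ⊗ i ⟶ j ⊗ (z ⊗ z') :=
  (α_ z z' i).hom ≫ z ◁ h ≫ (α_ z s z').inv ≫ g ▷ z' ≫ (α_ j z z').hom

lemma tubeComp_naturality {z z' m l i s j : C} (g : z ⊗ s ⟶ j ⊗ z) (h : z' ⊗ i ⟶ s ⊗ z')
    (a : m ⟶ z) (a' : z ⟶ m) (b : l ⟶ z') (b' : z' ⟶ l) :
    (α_ m l i).hom ≫ m ◁ (b ▷ i ≫ h ≫ s ◁ b') ≫ (α_ m s l).inv ≫
      (a ▷ s ≫ g ≫ j ◁ a') ▷ l ≫ (α_ j m l).hom =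
    (a ⊗ₘ b) ▷ i ≫ tubeComp g h ≫ j ◁ (a' ⊗ₘ b') := by
  have e1 : m ◁ s ◁ b' ≫ (α_ m s l).inv ≫ (a ▷ s) ▷ l =
      a ▷ (s ⊗ z') ≫ (α_ z s z').inv ≫ (z ⊗ s) ◁ b' := by
    rw [associator_inv_naturality_right_assoc, whisker_exchange,
      associator_inv_naturality_left_assoc]
  rw [tubeComp, MonoidalCategory.tensorHom_def, MonoidalCategory.tensorHom_def]
  simp only [MonoidalCategory.whiskerLeft_comp, comp_whiskerRight, Category.assoc]
  rw [reassoc_of% e1, whisker_exchange_assoc, whisker_exchange_assoc, whisker_exchange_assoc,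
    whisker_exchange_assoc]
  simp

end Monoidal

section Tensor

open CStarCategory CStarTensorCategory

variable {C : Type u} [Category.{v} C] [Preadditive C] [Linear ℂ C] [MonoidalCategory C]
  [CStarTensorCategory C]

namespace IrrChoice

variable (D : IrrChoice C) [IsRigid C]

lemma tubeMul_apply {i s j : C} (f : D.Fam s j) (g : D.Fam i s) {F G : Finset D.Irr}
    (hf : ∀ m ∉ F, f m = 0) (hg : ∀ l ∉ G, g l = 0) (k : D.Irr) :
    D.tubeMul f g k = ∑ m ∈ F, ∑ l ∈ G, ∑ V ∈ onbFinset (k : C) ((m : C) ⊗ (l : C)),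
      V ▷ i ≫ (α_ (m : C) (l : C) i).hom ≫ (m : C) ◁ g l ≫ (α_ (m : C) s (l : C)).inv ≫
        f m ▷ (l : C) ≫ (α_ j (m : C) (l : C)).hom ≫ j ◁ V† := by
  have hk := D.simple _ k.2
  simp only [tubeMul, finsum_mem_onb hk]
  rw [finsum_eq_sum_of_support_subset (s := F)]
  · refine Finset.sum_congr rfl fun m _ => ?_
    rw [finsum_eq_sum_of_support_subset (s := G)]
    intro l hl
    by_contra h
    exact hl (Finset.sum_eq_zero fun V _ => by simp [hg l h])
  · intro m hm
    by_contra h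
    exact hm (by simp [hf m h])

/-- Orthonormal bases for the simple constituents of `z`, `z'` and their tensor products give
a frame for the morphisms to `z ⊗ z'`. -/
lemma isDualFrame_tensor (k : D.Irr) (z z' : C) :
    IsDualFrame ((D.suppFinset z ×ˢ D.suppFinset z').sigma fun p =>
        onbFinset (k : C) ((p.1 : C) ⊗ (p.2 : C)) ×ˢ
          (onbFinset (p.1 : C) z ×ˢ onbFinset (p.2 : C) z'))
      (fun q : (Σ p : D.Irr × D.Irr, ((k : C) ⟶ (p.1 : C) ⊗ (p.2 : C)) ×
        (((p.1 : C) ⟶ z) × ((p.2 : C) ⟶ z'))) => q.2.1 ≫ (q.2.2.1 ⊗ₘ q.2.2.2))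
      (fun q => q.2.1 ≫ (q.2.2.1 ⊗ₘ q.2.2.2)) := by
  intro f
  have hk := D.simple _ k.2
  rw [Finset.sum_sigma, Finset.sum_product]
  simp only [Finset.sum_product]
  calc _ = ∑ m ∈ D.suppFinset z, ∑ l ∈ D.suppFinset z', ∑ a ∈ onbFinset (m : C) z,
        ∑ b ∈ onbFinset (l : C) z', f ≫ ((a† ≫ a) ⊗ₘ (b† ≫ b)) := by
        refine Finset.sum_congr rfl fun m _ => Finset.sum_congr rfl fun l _ => ?_
        rw [Finset.sum_comm]
        refine Finset.sum_congr rfl fun a _ => ?_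
        rw [Finset.sum_comm]
        refine Finset.sum_congr rfl fun b _ => ?_
        have h := sum_onbFinset hk (f ≫ (a† ⊗ₘ b†))
        rw [← tensorHom_comp_tensorHom, ← Category.assoc, ← h, Preadditive.sum_comp]
        refine Finset.sum_congr rfl fun V _ => ?_
        simp [dag_tensor]
    _ = f ≫ ((∑ m ∈ D.suppFinset z, ∑ a ∈ onbFinset (m : C) z, a† ≫ a) ⊗ₘ
          (∑ l ∈ D.suppFinset z', ∑ b ∈ onbFinset (l : C) z', b† ≫ b)) := by
        rw [sum_tensor, Preadditive.comp_sum]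
        refine Finset.sum_congr rfl fun m _ => ?_
        rw [tensor_sum, Preadditive.comp_sum]
        refine Finset.sum_congr rfl fun l _ => ?_
        rw [sum_tensor, Preadditive.comp_sum]
        refine Finset.sum_congr rfl fun a _ => ?_
        rw [tensor_sum, Preadditive.comp_sum]
    _ = f := by rw [sum_suppFinset, sum_suppFinset]; simp

/-- The tube product sums over bases for `m ⟶ z`, `l ⟶ z'` and `k ⟶ m ⊗ l`. Composed, these form a
frame for `k ⟶ z ⊗ z'`, and `Psi` may be computed in any frame. -/
lemma tubeMul_Psi {z z' i s j : C} (g : z ⊗ s ⟶ j ⊗ z) (h : z' ⊗ i ⟶ s ⊗ z') :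
    D.tubeMul (D.Psi g) (D.Psi h) = D.Psi (tubeComp g h) := by
  funext k
  have hsupp : ∀ {x y z : C} (g : z ⊗ x ⟶ y ⊗ z) (m : D.Irr), m ∉ D.suppFinset z → D.Psi g m = 0 :=
    fun g m hm => by rw [Psi_apply_onb, D.onbFinset_eq_empty' hm, Finset.sum_empty]
  rw [D.tubeMul_apply _ _ (hsupp g) (hsupp h), D.Psi_apply _ k (D.isDualFrame_tensor k z z'),
    Finset.sum_sigma, Finset.sum_product]
  refine Finset.sum_congr rfl fun m _ => ?_
  refine Finset.sum_congr rfl fun l _ => ?_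
  rw [Finset.sum_product]
  refine Finset.sum_congr rfl fun V _ => ?_
  rw [Finset.sum_product]
  simp only [Psi_apply_onb, whiskerLeft_sum, sum_whiskerRight, Preadditive.comp_sum,
    Preadditive.sum_comp]
  refine Finset.sum_congr rfl fun a _ => ?_
  refine Finset.sum_congr rfl fun b _ => ?_
  have e := tubeComp_naturality g h a (a†) b (b†)
  calc _ = V ▷ i ≫ ((α_ (m : C) (l : C) i).hom ≫ (m : C) ◁ (b ▷ i ≫ h ≫ s ◁ b†) ≫
        (α_ (m : C) s (l : C)).inv ≫ (a ▷ s ≫ g ≫ j ◁ a†) ▷ (l : C) ≫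
        (α_ j (m : C) (l : C)).hom) ≫ j ◁ V† := by simp only [Category.assoc]
    _ = _ := by
      rw [e, dag_comp, dag_tensor]
      simp only [comp_whiskerRight, MonoidalCategory.whiskerLeft_comp, Category.assoc]

end IrrChoice

end Tensor

/-! ### Bending, and `Psi` as a map compatible with the tube involution -/

section Monoidal

variable {C : Type u} [Category.{v} C] [MonoidalCategory C]

/-- The zigzag identities for a pair of morphisms exhibiting `Y` as a dual of `X`. -/
def IsDualPair {X Y : C} (η : 𝟙_ C ⟶ X ⊗ Y) (ε : Y ⊗ X ⟶ 𝟙_ C) : Prop :=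
  (ρ_ Y).inv ≫ Y ◁ η ≫ (α_ Y X Y).inv ≫ ε ▷ Y ≫ (λ_ Y).hom = 𝟙 Y ∧
  (λ_ X).inv ≫ η ▷ X ≫ (α_ X Y X).hom ≫ X ◁ ε ≫ (ρ_ X).hom = 𝟙 X

/-- The morphism `Y ⟶ k` obtained by bending `t : 𝟙 ⟶ X ⊗ k`. -/
def bendUnit {X Y k : C} (ε : Y ⊗ X ⟶ 𝟙_ C) (t : 𝟙_ C ⟶ X ⊗ k) : Y ⟶ k :=
  (ρ_ Y).inv ≫ Y ◁ t ≫ (α_ Y X k).inv ≫ ε ▷ k ≫ (λ_ k).hom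

/-- The morphism `k ⟶ Y` obtained by bending `s : k ⊗ X ⟶ 𝟙`. -/
def bendCounit {X Y k : C} (η : 𝟙_ C ⟶ X ⊗ Y) (s : k ⊗ X ⟶ 𝟙_ C) : k ⟶ Y :=
  (ρ_ k).inv ≫ k ◁ η ≫ (α_ k X Y).inv ≫ s ▷ Y ≫ (λ_ Y).hom

lemma IsDualPair.unit_bendUnit {X Y k : C} {η : 𝟙_ C ⟶ X ⊗ Y} {ε : Y ⊗ X ⟶ 𝟙_ C}
    (h : IsDualPair η ε) (t : 𝟙_ C ⟶ X ⊗ k) : η ≫ X ◁ bendUnit ε t = t := by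
  calc η ≫ X ◁ bendUnit ε t
      = 𝟙 _ ⊗≫ (η ▷ (𝟙_ C) ≫ (X ⊗ Y) ◁ t) ⊗≫ X ◁ ε ▷ k ⊗≫ 𝟙 _ := by
        rw [bendUnit]; monoidal
    _ = 𝟙 _ ⊗≫ t ⊗≫ ((λ_ X).inv ≫ η ▷ X ≫ (α_ X Y X).hom ≫ X ◁ ε ≫ (ρ_ X).hom) ▷ k ⊗≫ 𝟙 _ := by
        rw [← whisker_exchange]; monoidal
    _ = t := by rw [h.2]; monoidal

lemma IsDualPair.bendCounit_counit {X Y k : C} {η : 𝟙_ C ⟶ X ⊗ Y} {ε : Y ⊗ X ⟶ 𝟙_ C}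
    (h : IsDualPair η ε) (s : k ⊗ X ⟶ 𝟙_ C) : bendCounit η s ▷ X ≫ ε = s := by
  calc bendCounit η s ▷ X ≫ ε
      = 𝟙 _ ⊗≫ k ◁ η ▷ X ⊗≫ (s ▷ (Y ⊗ X) ≫ (𝟙_ C) ◁ ε) ⊗≫ 𝟙 _ := by
        rw [bendCounit]; monoidal
    _ = 𝟙 _ ⊗≫ k ◁ ((λ_ X).inv ≫ η ▷ X ≫ (α_ X Y X).hom ≫ X ◁ ε ≫ (ρ_ X).hom) ⊗≫ s ⊗≫ 𝟙 _ := by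
        rw [← whisker_exchange]; monoidal
    _ = s := by rw [h.2]; monoidal

lemma IsDualPair.bendCounit_comp_counit {X Y k : C} {η : 𝟙_ C ⟶ X ⊗ Y} {ε : Y ⊗ X ⟶ 𝟙_ C}
    (h : IsDualPair η ε) (f : k ⟶ Y) : bendCounit η (f ▷ X ≫ ε) = f := by
  calc bendCounit η (f ▷ X ≫ ε)
      = 𝟙 _ ⊗≫ (k ◁ η ≫ f ▷ (X ⊗ Y)) ⊗≫ ε ▷ Y ⊗≫ 𝟙 _ := by
        rw [bendCounit]; monoidal
    _ = f ⊗≫ ((ρ_ Y).inv ≫ Y ◁ η ≫ (α_ Y X Y).inv ≫ ε ▷ Y ≫ (λ_ Y).hom) ⊗≫ 𝟙 _ := by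
        rw [whisker_exchange]; monoidal
    _ = f := by rw [h.1]; monoidal

lemma IsDualPair.exists_whiskerLeft_counit {X Y Z : C} {η : 𝟙_ C ⟶ X ⊗ Y} {ε : Y ⊗ X ⟶ 𝟙_ C}
    (h : IsDualPair η ε) (s : Y ⊗ Z ⟶ 𝟙_ C) : ∃ f : Z ⟶ X, Y ◁ f ≫ ε = s := by
  refine ⟨(λ_ Z).inv ≫ η ▷ Z ≫ (α_ X Y Z).hom ≫ X ◁ s ≫ (ρ_ X).hom, ?_⟩
  calc _ = 𝟙 _ ⊗≫ Y ◁ η ▷ Z ⊗≫ ((Y ⊗ X) ◁ s ≫ ε ▷ (𝟙_ C)) ⊗≫ 𝟙 _ := by monoidal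
    _ = 𝟙 _ ⊗≫ ((ρ_ Y).inv ≫ Y ◁ η ≫ (α_ Y X Y).inv ≫ ε ▷ Y ≫ (λ_ Y).hom) ▷ Z ⊗≫ s ⊗≫ 𝟙 _ := by
        rw [whisker_exchange]; monoidal
    _ = s := by rw [h.1]; monoidal

/-- The rotation of `g : j ⊗ X ⟶ X ⊗ i` by a unit and a counit, as in the definition of the tube
involution. -/
def tubeRotate {X Y i j : C} (η : 𝟙_ C ⟶ X ⊗ Y) (ε : Y ⊗ X ⟶ 𝟙_ C) (g : j ⊗ X ⟶ X ⊗ i) :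
    Y ⊗ j ⟶ i ⊗ Y :=
  (ρ_ (Y ⊗ j)).inv ≫ (Y ⊗ j) ◁ η ≫ (α_ Y j (X ⊗ Y)).hom ≫ Y ◁ (α_ j X Y).inv ≫
    Y ◁ (g ▷ Y) ≫ Y ◁ (α_ X i Y).hom ≫ (α_ Y X (i ⊗ Y)).inv ≫ ε ▷ (i ⊗ Y) ≫ (λ_ (i ⊗ Y)).hom

/-- Morphisms on the rotated strand slide around the cup and the cap: `hb` and `hb'` say that `b`
and `b'` are the transposes of `a` and `a'`. -/
lemma tubeRotate_naturality {X Y X' Y' i j : C} (η : 𝟙_ C ⟶ X ⊗ Y) (ε : Y ⊗ X ⟶ 𝟙_ C)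
    (η' : 𝟙_ C ⟶ X' ⊗ Y') (ε' : Y' ⊗ X' ⟶ 𝟙_ C) (g : j ⊗ X' ⟶ X' ⊗ i)
    {a : X ⟶ X'} {b : Y' ⟶ Y} (hb : η ≫ a ▷ Y = η' ≫ X' ◁ b)
    {a' : X' ⟶ X} {b' : Y ⟶ Y'} (hb' : Y ◁ a' ≫ ε = b' ▷ X' ≫ ε') :
    tubeRotate η ε (j ◁ a ≫ g ≫ a' ▷ i) = b' ▷ j ≫ tubeRotate η' ε' g ≫ i ◁ b := by
  -- `Q` and `M` are the blocks past which `b` and `b'` respectively are moved by the interchange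
  -- law.
  let Q : Y ⊗ (j ⊗ X') ⟶ i := Y ◁ g ⊗≫ b' ▷ (X' ⊗ i) ⊗≫ ε' ▷ i ⊗≫ 𝟙 i
  let M : j ⟶ (X' ⊗ i) ⊗ Y' := (ρ_ j).inv ≫ j ◁ η' ≫ (α_ j X' Y').inv ≫ g ▷ Y'
  calc tubeRotate η ε (j ◁ a ≫ g ≫ a' ▷ i)
      = 𝟙 _ ⊗≫ (Y ⊗ j) ◁ (η ≫ a ▷ Y) ⊗≫ Y ◁ g ▷ Y ⊗≫ (Y ◁ a' ≫ ε) ▷ (i ⊗ Y) ⊗≫ 𝟙 _ := by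
        rw [tubeRotate]; monoidal
    _ = 𝟙 _ ⊗≫ (Y ⊗ j) ◁ η' ⊗≫ ((Y ⊗ (j ⊗ X')) ◁ b ≫ Q ▷ Y) := by
        rw [hb, hb']; simp only [Q]; monoidal
    _ = 𝟙 _ ⊗≫ (Y ◁ M ≫ b' ▷ ((X' ⊗ i) ⊗ Y')) ⊗≫ ε' ▷ (i ⊗ Y') ⊗≫ i ◁ b := by
        rw [whisker_exchange]; simp only [Q, M]; monoidal
    _ = b' ▷ j ≫ tubeRotate η' ε' g ≫ i ◁ b := by
        rw [whisker_exchange]; simp only [M, tubeRotate]; monoidal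

end Monoidal

section Tensor

open CStarCategory CStarTensorCategory

variable {C : Type u} [Category.{v} C] [Preadditive C] [Linear ℂ C] [MonoidalCategory C]
  [CStarTensorCategory C]

lemma ConjugateEquations.symm {X Xbar : C} {R : 𝟙_ C ⟶ Xbar ⊗ X} {Rbar : 𝟙_ C ⟶ X ⊗ Xbar}
    (h : ConjugateEquations R Rbar) : ConjugateEquations Rbar R := ⟨h.2, h.1⟩

lemma ConjugateEquations.isDualPair {X Xbar : C} {R : 𝟙_ C ⟶ Xbar ⊗ X}
    {Rbar : 𝟙_ C ⟶ X ⊗ Xbar} (h : ConjugateEquations R Rbar) : IsDualPair R (Rbar†) := by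
  refine ⟨?_, h.1⟩
  have h2 := congrArg CStarCategory.dag h.2
  simpa only [dag_comp, dag_id, dag_whiskerLeft, dag_whiskerRight, dag_associator, dag_dag,
    dag_leftUnitor_inv, dag_rightUnitor, Category.assoc] using h2

lemma bendCounit_sum {X Y k : C} (η : 𝟙_ C ⟶ X ⊗ Y) {ι : Type*} (t : Finset ι) (c : ι → ℂ)
    (s : ι → (k ⊗ X ⟶ 𝟙_ C)) :
    bendCounit η (∑ i ∈ t, c i • s i) = ∑ i ∈ t, c i • bendCounit η (s i) := by
  simp only [bendCounit, sum_whiskerRight, Preadditive.sum_comp, Preadditive.comp_sum,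
    MonoidalLinear.smul_whiskerRight, Linear.smul_comp, Linear.comp_smul]

namespace IrrChoice

variable (D : IrrChoice C)

lemma tubeStar_apply {i j : C} (f : D.Fam i j) (k : D.Irr) :
    D.tubeStar f k = tubeRotate (D.R k) ((D.Rbar k)†) ((f (D.bar k))†) := rfl

variable [IsRigid C]

/-- Rotating an orthonormal basis of the morphisms from `k̄` to `z` gives a dual frame of the
morphisms from `k` to `z̄`. -/
lemma isDualFrame_bend (k : D.Irr) {z zbar : C} {R : 𝟙_ C ⟶ zbar ⊗ z} {Rbar : 𝟙_ C ⟶ z ⊗ zbar}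
    (h : ConjugateEquations R Rbar) :
    IsDualFrame (onbFinset (D.bar k : C) z)
      (fun V => bendCounit Rbar ((k : C) ◁ V† ≫ (D.Rbar k)†))
      (fun V => (bendUnit (R†) (D.R k ≫ V ▷ (k : C)))†) := by
  intro f
  have hk := (D.standard k).1.isDualPair
  have hz := h.symm.isDualPair
  have hkb := D.simple _ (D.bar k).2
  -- The transpose `s : z ⟶ k̄` of `f`. Expanding it in the adjoints `V†` of the basis and bending
  -- back expands `f`, with the coefficients identified in `h1`.
  obtain ⟨s, hs⟩ := hk.exists_whiskerLeft_counit (f ▷ z ≫ R†)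
  choose c hc using fun V : (D.bar k : C) ⟶ z => hkb.2 (V ≫ s)
  have h1 : ∀ V, f ≫ bendUnit (R†) (D.R k ≫ V ▷ (k : C)) = c V • 𝟙 (k : C) := fun V => by
    calc f ≫ bendUnit (R†) (D.R k ≫ V ▷ (k : C))
        = 𝟙 _ ⊗≫ (f ▷ (𝟙_ C) ≫ zbar ◁ (D.R k ≫ V ▷ (k : C))) ⊗≫ (R†) ▷ (k : C) ⊗≫ 𝟙 _ := by
          rw [bendUnit]; monoidal
      _ = 𝟙 _ ⊗≫ (k : C) ◁ (D.R k ≫ V ▷ (k : C)) ⊗≫ (f ▷ z ≫ R†) ▷ (k : C) ⊗≫ 𝟙 _ := by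
          rw [← whisker_exchange]; monoidal
      _ = (ρ_ (k : C)).inv ≫ (k : C) ◁ (D.R k ≫ (V ≫ s) ▷ (k : C)) ≫ (α_ _ _ _).inv ≫
          ((D.Rbar k)†) ▷ (k : C) ≫ (λ_ (k : C)).hom := by
          rw [← hs]; monoidal
      _ = c V • 𝟙 (k : C) := by
          rw [hc, MonoidalLinear.smul_whiskerRight, id_whiskerRight, Linear.comp_smul,
            Category.comp_id, MonoidalLinear.whiskerLeft_smul, Linear.smul_comp,
            Linear.comp_smul, hk.1]
  have h2 : f ▷ z ≫ R† =
      ∑ V ∈ onbFinset (D.bar k : C) z, c V • ((k : C) ◁ V† ≫ (D.Rbar k)†) := by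
    rw [← hs]
    conv_lhs => rw [← (IsDualFrame.onb hkb z).dag s]
    rw [whiskerLeft_sum, Preadditive.sum_comp]
    refine Finset.sum_congr rfl fun V _ => ?_
    rw [hc, Linear.comp_smul, Category.comp_id, MonoidalLinear.whiskerLeft_smul,
      Linear.smul_comp]
  conv_rhs => rw [← hz.bendCounit_comp_counit f, h2, bendCounit_sum]
  refine Finset.sum_congr rfl fun V _ => ?_
  rw [dag_dag, ← Category.assoc, h1, Linear.smul_comp, Category.id_comp]

/-- The involution at `k` rotates the component at `k̄`, turning its orthonormal basis into a pair
of dual families for `k ⟶ z̄`. These need not be orthonormal, which is why dual frames are used. -/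
lemma tubeStar_Psi {z zbar i j : C} {R : 𝟙_ C ⟶ zbar ⊗ z} {Rbar : 𝟙_ C ⟶ z ⊗ zbar}
    (h : ConjugateEquations R Rbar) (g : z ⊗ i ⟶ j ⊗ z) :
    D.tubeStar (D.Psi g) = D.Psi (tubeRotate Rbar (R†) (g†)) := by
  funext k
  have hz := h.symm.isDualPair
  rw [tubeStar_apply, D.Psi_apply _ k (D.isDualFrame_bend k h), Psi_apply_onb, dag_sum]
  have h1 : ∀ (s : Finset ((D.bar k : C) ⟶ z))
      (F : ((D.bar k : C) ⟶ z) → (j ⊗ (D.bar k : C) ⟶ (D.bar k : C) ⊗ i)),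
      tubeRotate (D.R k) ((D.Rbar k)†) (∑ V ∈ s, F V) =
        ∑ V ∈ s, tubeRotate (D.R k) ((D.Rbar k)†) (F V) := fun s F => by
    simp only [tubeRotate, sum_whiskerRight, whiskerLeft_sum, Preadditive.sum_comp,
      Preadditive.comp_sum]
  rw [h1]
  refine Finset.sum_congr rfl fun V _ => ?_
  rw [dag_dag, ← tubeRotate_naturality (D.R k) ((D.Rbar k)†) Rbar (R†) (g†)
    (hz.unit_bendUnit (D.R k ≫ V ▷ (k : C))).symm
    (hz.bendCounit_counit ((k : C) ◁ V† ≫ (D.Rbar k)†)).symm]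
  simp

end IrrChoice

end Tensor

/-! ### The positive map from `End(z ⊗ z̄)` to the tube cone -/

section Tensor

open CStarCategory CStarTensorCategory

variable {C : Type u} [Category.{v} C] [Preadditive C] [Linear ℂ C] [MonoidalCategory C]
  [CStarTensorCategory C]

/-- The morphism `(S ⊗ 1) (1 ⊗ R)` from `z` to `y ⊗ z`. -/
def bendIn {y z zbar : C} (R : 𝟙_ C ⟶ zbar ⊗ z) (S : z ⊗ zbar ⟶ y) : z ⊗ 𝟙_ C ⟶ y ⊗ z :=
  z ◁ R ≫ (α_ z zbar z).inv ≫ S ▷ z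

/-- The morphism `(R† ⊗ 1) (1 ⊗ S†)` from `z̄ ⊗ y` to `z̄`. -/
def bendOut {y z zbar : C} (R : 𝟙_ C ⟶ zbar ⊗ z) (S : z ⊗ zbar ⟶ y) :
    zbar ⊗ y ⟶ 𝟙_ C ⊗ zbar :=
  zbar ◁ S† ≫ (α_ zbar z zbar).inv ≫ R† ▷ zbar

/-- The morphism `(R† ⊗ 1) (1 ⊗ σ ⊗ 1) (1 ⊗ R)` on `z̄ ⊗ z`. -/
def sandwich {z zbar : C} (R : 𝟙_ C ⟶ zbar ⊗ z) (σ : z ⊗ zbar ⟶ z ⊗ zbar) :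
    (zbar ⊗ z) ⊗ 𝟙_ C ⟶ 𝟙_ C ⊗ (zbar ⊗ z) :=
  (α_ zbar z (𝟙_ C)).hom ≫ zbar ◁ (z ◁ R ≫ (α_ z zbar z).inv ≫ σ ▷ z) ≫
    (α_ zbar (z ⊗ zbar) z).inv ≫ ((α_ zbar z zbar).inv ≫ R† ▷ zbar) ▷ z ≫
    (α_ (𝟙_ C) zbar z).hom

section

variable {y z zbar : C} {R : 𝟙_ C ⟶ zbar ⊗ z} {Rbar : 𝟙_ C ⟶ z ⊗ zbar}

lemma bendIn_rotate (h : ConjugateEquations R Rbar) (γ : z ⟶ y ⊗ z) :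
    bendIn R (rotate Rbar γ) = (ρ_ z).hom ≫ γ := by
  calc bendIn R (rotate Rbar γ)
      = 𝟙 _ ⊗≫ (z ◁ R ≫ γ ▷ (zbar ⊗ z)) ⊗≫ y ◁ (Rbar† ▷ z) ⊗≫ 𝟙 _ := by
        rw [bendIn, rotate]; monoidal
    _ = 𝟙 _ ⊗≫ γ ⊗≫
        y ◁ ((ρ_ z).inv ≫ z ◁ R ≫ (α_ z zbar z).inv ≫ Rbar† ▷ z ≫ (λ_ z).hom) ⊗≫ 𝟙 _ := by
        rw [whisker_exchange]; monoidal
    _ = (ρ_ z).hom ≫ γ := by rw [h.isDualPair.1]; monoidal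

lemma tubeRotate_bendIn (h : ConjugateEquations R Rbar) (S : z ⊗ zbar ⟶ y) :
    tubeRotate Rbar (R†) ((bendIn R S)†) = bendOut R S := by
  calc tubeRotate Rbar (R†) ((bendIn R S)†)
      = 𝟙 _ ⊗≫ zbar ◁ (y ◁ Rbar ≫ S† ▷ (z ⊗ zbar)) ⊗≫ (zbar ⊗ z) ◁ (R† ▷ zbar) ⊗≫
          R† ▷ zbar ⊗≫ 𝟙 _ := by
        simp only [tubeRotate, bendIn, dag_comp, dag_whiskerLeft, dag_whiskerRight,
          dag_associator_inv]
        monoidal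
    _ = zbar ◁ S† ⊗≫ (zbar ⊗ z) ◁ ((ρ_ zbar).inv ≫ zbar ◁ Rbar ≫ (α_ zbar z zbar).inv ≫
          R† ▷ zbar ≫ (λ_ zbar).hom) ⊗≫ R† ▷ zbar ⊗≫ 𝟙 _ := by
        rw [whisker_exchange]; monoidal
    _ = bendOut R S := by rw [h.symm.isDualPair.1, bendOut]; monoidal

/-- With `a` the image of `bendOut R S` under `Psi`, this identifies `a^*` as the image of `bendIn R
S`, so that their product has the form `a a^*`. -/
lemma tubeRotate_bendOut (h : ConjugateEquations R Rbar) (S : z ⊗ zbar ⟶ y) :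
    tubeRotate R (Rbar†) ((bendOut R S)†) = bendIn R S := by
  calc tubeRotate R (Rbar†) ((bendOut R S)†)
      = 𝟙 _ ⊗≫ z ◁ R ⊗≫ z ◁ R ▷ (zbar ⊗ z) ⊗≫
          ((z ⊗ zbar) ◁ S ≫ Rbar† ▷ y) ▷ z ⊗≫ 𝟙 _ := by
        simp only [tubeRotate, bendOut, dag_comp, dag_whiskerLeft, dag_whiskerRight,
          dag_associator_inv, dag_dag]
        monoidal
    _ = 𝟙 _ ⊗≫ z ◁ R ⊗≫ ((ρ_ z).inv ≫ z ◁ R ≫ (α_ z zbar z).inv ≫ Rbar† ▷ z ≫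
          (λ_ z).hom) ▷ (zbar ⊗ z) ⊗≫ S ▷ z ⊗≫ 𝟙 _ := by
        rw [whisker_exchange]; monoidal
    _ = bendIn R S := by rw [h.isDualPair.1, bendIn]; monoidal

variable (R) in
lemma tubeComp_bendOut_bendIn (S : z ⊗ zbar ⟶ y) :
    tubeComp (bendOut R S) (bendIn R S) = sandwich R (S ≫ S†) := by
  rw [tubeComp, bendOut, bendIn, sandwich]; monoidal

variable (R) in
lemma sandwich_id : sandwich R (𝟙 (z ⊗ zbar)) = R† ▷ 𝟙_ C ≫ 𝟙_ C ◁ R := by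
  rw [← whisker_exchange, sandwich]; monoidal

variable (R) in
lemma sandwich_sum {ι : Type*} (s : Finset ι) (σ : ι → (z ⊗ zbar ⟶ z ⊗ zbar)) :
    sandwich R (∑ i ∈ s, σ i) = ∑ i ∈ s, sandwich R (σ i) := by
  simp only [sandwich, sum_whiskerRight, whiskerLeft_sum, Preadditive.sum_comp,
    Preadditive.comp_sum]

variable (R) in
lemma sandwich_add (σ τ : z ⊗ zbar ⟶ z ⊗ zbar) :
    sandwich R (σ + τ) = sandwich R σ + sandwich R τ := by
  simp only [sandwich, MonoidalPreadditive.add_whiskerRight, MonoidalPreadditive.whiskerLeft_add,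
    Preadditive.add_comp, Preadditive.comp_add]

variable (R) in
lemma sandwich_smul (c : ℂ) (σ : z ⊗ zbar ⟶ z ⊗ zbar) :
    sandwich R (c • σ) = c • sandwich R σ := by
  simp only [sandwich, MonoidalLinear.smul_whiskerRight, MonoidalLinear.whiskerLeft_smul,
    Linear.smul_comp, Linear.comp_smul]

end

namespace IrrChoice

variable (D : IrrChoice C)

lemma tubeMul_tubeStar_mem_tubeCone {x : D.Irr} {a : D.Fam (x : C) (𝟙_ C)}
    (ha : a ∈ D.tube (x : C) (𝟙_ C)) : D.tubeMul a (D.tubeStar a) ∈ D.tubeCone :=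
  ⟨1, fun _ => x, fun _ => a, fun _ => ha, by simp⟩

lemma zero_mem_tubeCone : (0 : D.Fam (𝟙_ C) (𝟙_ C)) ∈ D.tubeCone :=
  ⟨0, Fin.elim0, fun i => i.elim0, fun i => i.elim0, by simp⟩

lemma add_mem_tubeCone {c d : D.Fam (𝟙_ C) (𝟙_ C)} (hc : c ∈ D.tubeCone) (hd : d ∈ D.tubeCone) :
    c + d ∈ D.tubeCone := by
  obtain ⟨n, x, a, ha, rfl⟩ := hc
  obtain ⟨m, y, b, hb, rfl⟩ := hd
  -- Objects and elements are concatenated as pairs, since the type of each element depends on its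
  -- object.
  let f : Fin (n + m) → Σ x : D.Irr, D.Fam (x : C) (𝟙_ C) :=
    Fin.append (fun i => ⟨x i, a i⟩) (fun i => ⟨y i, b i⟩)
  have key : ∀ P : (Σ x : D.Irr, D.Fam (x : C) (𝟙_ C)) → Prop, (∀ i, P ⟨x i, a i⟩) →
      (∀ i, P ⟨y i, b i⟩) → ∀ i, P (f i) := fun P h1 h2 =>
    Fin.addCases (fun i => by simp only [f, Fin.append_left]; exact h1 i)
      (fun i => by simp only [f, Fin.append_right]; exact h2 i)
  refine ⟨n + m, fun i => (f i).1, fun i => (f i).2,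
    key (fun p => p.2 ∈ D.tube (p.1 : C) (𝟙_ C)) ha hb, ?_⟩
  · rw [Fin.sum_univ_add]
    congr 1
    · refine Finset.sum_congr rfl fun i _ => ?_
      simp only [f]; rw [Fin.append_left]
    · refine Finset.sum_congr rfl fun i _ => ?_
      simp only [f]; rw [Fin.append_right]

lemma sum_mem_tubeCone {ι : Type*} (s : Finset ι) {c : ι → D.Fam (𝟙_ C) (𝟙_ C)}
    (hc : ∀ i ∈ s, c i ∈ D.tubeCone) : ∑ i ∈ s, c i ∈ D.tubeCone :=
  Finset.sum_induction c (· ∈ D.tubeCone) (fun _ _ => D.add_mem_tubeCone) D.zero_mem_tubeCone hc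

variable [IsRigid C]

/-- Positivity of the map. The cone admits only simple intermediate objects, so `1_y` is first
resolved as a sum of `V† ≫ V`; each `S ≫ V†` then contributes one `a a^*`. -/
lemma Psi_sandwich_mem_tubeCone {y z zbar : C} {R : 𝟙_ C ⟶ zbar ⊗ z} {Rbar : 𝟙_ C ⟶ z ⊗ zbar}
    (h : ConjugateEquations R Rbar) (S : z ⊗ zbar ⟶ y) :
    D.Psi (sandwich R (S ≫ S†)) ∈ D.tubeCone := by
  have h1 : S ≫ S† = ∑ w ∈ D.suppFinset y, ∑ V ∈ onbFinset (w : C) y,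
      (S ≫ V†) ≫ (S ≫ V†)† := by
    calc S ≫ S† = S ≫ 𝟙 y ≫ S† := by rw [Category.id_comp]
      _ = _ := by
        rw [← D.sum_suppFinset y]
        simp [Preadditive.sum_comp, Preadditive.comp_sum]
  rw [h1, sandwich_sum, Psi_sum]
  refine D.sum_mem_tubeCone _ fun w _ => ?_
  rw [sandwich_sum, Psi_sum]
  refine D.sum_mem_tubeCone _ fun V _ => ?_
  rw [← tubeComp_bendOut_bendIn, ← tubeMul_Psi]
  have h2 := D.tubeStar_Psi h.symm (bendOut R (S ≫ V†))
  rw [tubeRotate_bendOut h] at h2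
  rw [← h2]
  exact D.tubeMul_tubeStar_mem_tubeCone (D.Psi_mem_tube _)

lemma toTube_of (z : D.Irr) : D.toTube (D.of z) = D.Psi ((ρ_ (z : C)).hom ≫ (λ_ (z : C)).inv) := by
  funext w
  by_cases hwz : w = z
  · subst hwz
    -- The chosen basis of `End(w)` is known only up to a phase; frame independence permits the
    -- identity instead.
    have hf : IsDualFrame (Finset.univ : Finset Unit) (fun _ => 𝟙 (w : C)) (fun _ => 𝟙 (w : C)) :=
      fun f => by simp
    rw [D.Psi_apply _ w hf]
    simp [toTube, coeff, of]
  · rw [Psi_apply_onb, D.onbFinset_eq_empty, Finset.sum_empty]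
    · simp [toTube, coeff, of, Finsupp.single_eq_of_ne hwz]
    · rintro ⟨f, hf⟩
      exact hf (D.hom_eq_zero hwz f)

lemma toTube_one : D.toTube 1 = D.Psi (𝟙 (𝟙_ C ⊗ 𝟙_ C)) := by
  have h := D.toTube_of ⟨𝟙_ C, D.unit_mem⟩
  rw [show (1 : D.FusionAlgebra) = D.of ⟨𝟙_ C, D.unit_mem⟩ from rfl, h,
    ← unitors_equal, Iso.hom_inv_id]

/-- With nothing in the middle the diagram splits into `R†` followed by `R`; cyclicity reverses
their order and leaves the scalar `R† R` on the unit object. -/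
lemma Psi_sandwich_id {z zbar : C} (R : 𝟙_ C ⟶ zbar ⊗ z) :
    D.Psi (sandwich R (𝟙 (z ⊗ zbar))) = ((catDim R : ℝ) : ℂ) • D.toTube 1 := by
  rw [sandwich_id, Psi_cyclic, ← MonoidalCategory.whiskerLeft_comp, (unitScalar_comp_dag R).1,
    MonoidalLinear.whiskerLeft_smul, Psi_smul, toTube_one, whiskerLeft_id, catDim]

lemma tubeMul_tubeStar_Psi {y z zbar : C} {R : 𝟙_ C ⟶ zbar ⊗ z} {Rbar : 𝟙_ C ⟶ z ⊗ zbar}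
    (h : ConjugateEquations R Rbar) (γ : z ⟶ y ⊗ z) :
    D.tubeMul (D.tubeStar (D.Psi ((ρ_ z).hom ≫ γ))) (D.Psi ((ρ_ z).hom ≫ γ)) =
      D.Psi (sandwich R (sigmaElt Rbar γ)) := by
  rw [← bendIn_rotate h, D.tubeStar_Psi h, tubeRotate_bendIn h, tubeMul_Psi,
    tubeComp_bendOut_bendIn, sigmaElt]

/-- The estimate `b^* b ≤ ‖σ‖ d(z)`. -/
lemma smul_one_sub_tubeMul_tubeStar_mem {y z zbar : C} {R : 𝟙_ C ⟶ zbar ⊗ z}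
    {Rbar : 𝟙_ C ⟶ z ⊗ zbar} (h : ConjugateEquations R Rbar) (γ : z ⟶ y ⊗ z) :
    ((‖sigmaElt Rbar γ‖ * catDim R : ℝ) : ℂ) • D.toTube 1
      - D.tubeMul (D.tubeStar (D.Psi ((ρ_ z).hom ≫ γ))) (D.Psi ((ρ_ z).hom ≫ γ))
      ∈ D.tubeCone := by
  -- Positivity of the map is applied to `‖σ‖ 1 - σ`, with `s` landing in `z ⊗ z̄` itself.
  obtain ⟨s, hs⟩ := exists_norm_smul_sub_eq (sigmaElt Rbar γ) (by simp [sigmaElt])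
  have h1 := D.Psi_sandwich_mem_tubeCone h s
  rw [← hs, sub_eq_add_neg, ← neg_one_smul ℂ (sigmaElt Rbar γ), sandwich_add, sandwich_smul,
    sandwich_smul, Psi_add, Psi_smul, Psi_smul, Psi_sandwich_id, ← D.tubeMul_tubeStar_Psi h,
    neg_one_smul, ← sub_eq_add_neg, smul_smul, ← Complex.ofReal_mul] at h1
  exact h1

end IrrChoice

end Tensor

/-! ### The fusion algebra inside the tube algebra -/

section Tensor

open CStarCategory CStarTensorCategory

variable {C : Type u} [Category.{v} C] [Preadditive C] [Linear ℂ C] [MonoidalCategory C]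
  [CStarTensorCategory C]

lemma card_onbFinset [IsRigid C] {w : C} (hw : IsSimpleObj w) (z : C) :
    (onbFinset w z).card = Module.finrank ℂ (w ⟶ z) := by
  have horth := isOrthonormal_onbFinset hw z
  have hli : LinearIndepOn ℂ id (onbFinset w z : Set (w ⟶ z)) := by
    rw [linearIndepOn_finset_iff]
    intro c hc V hV
    have h1 : (∑ W ∈ onbFinset w z, c W • id W) ≫ V† = 0 := by rw [hc, Limits.zero_comp]
    rw [Preadditive.sum_comp, Finset.sum_eq_single V, Linear.smul_comp, id, horth.1 V hV,
      smul_eq_zero] at h1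
    · exact h1.resolve_right hw.1
    · intro W hW hne
      rw [Linear.smul_comp, id, horth.2 V hV W hW hne.symm, smul_zero]
    · exact fun h => absurd hV h
  rw [← finrank_span_finset_eq_card hli, coe_onbFinset hw, (isOnb_onb hw z).2.2, finrank_top]

namespace IrrChoice

variable (D : IrrChoice C)

/-- The coefficient at a simple object as a linear functional. -/
def coeffₗ (k : D.Irr) : D.FusionAlgebra →ₗ[ℂ] ℂ := Finsupp.lapply (R := ℂ) k

lemma coeffₗ_apply (k : D.Irr) (a : D.FusionAlgebra) : D.coeffₗ k a = D.coeff a k := rfl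

open Classical in
lemma coeffₗ_of (k x : D.Irr) : D.coeffₗ k (D.of x) = if x = k then 1 else 0 :=
  Finsupp.single_apply

lemma toTube_add (a b : D.FusionAlgebra) : D.toTube (a + b) = D.toTube a + D.toTube b := by
  funext w
  exact add_smul (D.coeff a w) (D.coeff b w) _

lemma toTube_smul (c : ℂ) (a : D.FusionAlgebra) : D.toTube (c • a) = c • D.toTube a := by
  funext w
  exact mul_smul c (D.coeff a w) _

lemma toTube_sub (a b : D.FusionAlgebra) : D.toTube (a - b) = D.toTube a - D.toTube b := by
  funext w
  exact sub_smul (D.coeff a w) (D.coeff b w) _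

lemma toTube_mem_tube (a : D.FusionAlgebra) : D.toTube a ∈ D.tube (𝟙_ C) (𝟙_ C) := by
  refine (D.coeff a).support.finite_toSet.subset fun w hw => ?_
  rw [Finset.mem_coe, Finsupp.mem_support_iff]
  rintro h
  exact hw (by rw [toTube, h, zero_smul])

lemma toTube_injective : Function.Injective D.toTube := by
  intro a b h
  refine Finsupp.ext fun w => ?_
  change D.coeff a w = D.coeff b w
  refine (D.simple _ w.2).smul_id_injective ?_
  have h1 := congrArg (fun f => (ρ_ (w : C)).inv ≫ f ≫ (λ_ (w : C)).hom) (congrFun h w)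
  simpa [toTube] using h1

/-- Both objects are dual to `k̄`, so duality gives a morphism between them. Were it zero, the
counit for `k̄` would vanish and break the zigzag identity. -/
lemma bar_bar (k : D.Irr) : D.bar (D.bar k) = k := by
  by_contra hne
  have h1 := (D.standard k).1.symm.isDualPair
  have h2 := (D.standard (D.bar k)).1.isDualPair
  obtain ⟨f, hf⟩ := h1.exists_whiskerLeft_counit ((D.Rbar (D.bar k))†)
  rw [D.hom_eq_zero hne f, MonoidalPreadditive.whiskerLeft_zero, Limits.zero_comp] at hf
  apply (D.simple _ (D.bar k).2).1
  rw [← h2.1, ← hf, MonoidalPreadditive.zero_whiskerRight]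
  simp

lemma bar_one : D.bar ⟨𝟙_ C, D.unit_mem⟩ = ⟨𝟙_ C, D.unit_mem⟩ := by
  by_contra hne
  have h1 := (D.standard ⟨𝟙_ C, D.unit_mem⟩).1.isDualPair
  have h2 := D.hom_eq_zero (Ne.symm hne) (D.R ⟨𝟙_ C, D.unit_mem⟩ ≫ (ρ_ _).hom)
  have h3 : D.R ⟨𝟙_ C, D.unit_mem⟩ = 0 := by
    have h4 := congrArg (fun f => f ≫ (ρ_ _).inv) h2
    simpa using h4
  apply (unit_simple (C := C)).1
  rw [← h1.1, h3, MonoidalPreadditive.whiskerLeft_zero]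
  simp

lemma star_def (a : D.FusionAlgebra) :
    star a = (D.coeff a).sum fun x r => (starRingEnd ℂ r) • D.of (D.bar x) := rfl

lemma star_add' (a b : D.FusionAlgebra) : star (a + b) = star a + star b := by
  rw [star_def, show D.coeff (a + b) = D.coeff a + D.coeff b from rfl,
    Finsupp.sum_add_index' (by simp) (by intro x r s; rw [map_add, add_smul])]
  rfl

lemma star_smul_of (r : ℂ) (x : D.Irr) :
    star (r • D.of x) = (starRingEnd ℂ r) • D.of (D.bar x) := by
  have h : D.coeff (r • D.of x) = Finsupp.single x r := by
    conv_rhs => rw [← mul_one r]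
    exact Finsupp.smul_single' r x 1
  rw [star_def, h, Finsupp.sum_single_index (by simp)]

lemma star_of (x : D.Irr) : star (D.of x) = D.of (D.bar x) := by
  simpa using D.star_smul_of 1 x

lemma star_one' : star (1 : D.FusionAlgebra) = 1 := by
  change star (D.of ⟨𝟙_ C, D.unit_mem⟩) = D.of ⟨𝟙_ C, D.unit_mem⟩
  rw [star_of, bar_one]

lemma coeff_star (a : D.FusionAlgebra) (k : D.Irr) :
    D.coeff (star a) k = (starRingEnd ℂ) (D.coeff a (D.bar k)) := by
  classical
  rw [← coeffₗ_apply, star_def, Finsupp.sum, map_sum]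
  simp only [map_smul, coeffₗ_of, smul_eq_mul]
  rw [Finset.sum_eq_single (D.bar k)]
  · simp [bar_bar]
  · intro x _ hx
    rw [if_neg, mul_zero]
    rintro rfl
    exact hx (D.bar_bar x).symm
  · intro h
    rw [Finsupp.notMem_support_iff.1 h]
    simp

lemma star_star' (a : D.FusionAlgebra) : star (star a) = a := by
  refine Finsupp.ext fun k => ?_
  change D.coeff (star (star a)) k = D.coeff a k
  rw [coeff_star, coeff_star, bar_bar, Complex.conj_conj]

lemma eq_sum_smul_of (a : D.FusionAlgebra) :
    a = ∑ x ∈ (D.coeff a).support, D.coeff a x • D.of x := by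
  refine Finsupp.ext fun k => ?_
  change D.coeffₗ k a = D.coeffₗ k _
  classical
  rw [map_sum]
  simp only [map_smul, coeffₗ_of, smul_eq_mul]
  rw [coeffₗ_apply, Finset.sum_eq_single k]
  · simp
  · intro x _ hx
    rw [if_neg hx, mul_zero]
  · intro h
    rw [Finsupp.notMem_support_iff.1 h, zero_mul]

lemma mul_def (a b : D.FusionAlgebra) :
    a * b = (D.coeff a).sum fun x r => (D.coeff b).sum fun y s =>
    (r * s) • ∑ᶠ z : D.Irr,
      (Module.finrank ℂ ((z : C) ⟶ (x : C) ⊗ (y : C)) : ℂ) • D.of z := rfl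

lemma add_mul' (a b c : D.FusionAlgebra) : (a + b) * c = a * c + b * c := by
  rw [mul_def, show D.coeff (a + b) = D.coeff a + D.coeff b from rfl, Finsupp.sum_add_index']
  · rfl
  · intro x; simp
  · intro x r s
    simp only [add_mul, add_smul]
    exact Finsupp.sum_add

lemma mul_add' (a b c : D.FusionAlgebra) : a * (b + c) = a * b + a * c := by
  rw [mul_def, show D.coeff (b + c) = D.coeff b + D.coeff c from rfl, mul_def, mul_def,
    ← Finsupp.sum_add]
  refine Finsupp.sum_congr fun x _ => ?_
  rw [Finsupp.sum_add_index']
  · intro x; simp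
  · intro x r s
    simp only [mul_add, add_smul]

lemma add_mem_sigmaSq {a b : D.FusionAlgebra} (ha : a ∈ D.sigmaSq) (hb : b ∈ D.sigmaSq) :
    a + b ∈ D.sigmaSq := by
  have h := D.add_mem_tubeCone ha hb
  rwa [← toTube_add] at h

/-- Here `σ = R̄ R̄†`, whose norm is the scalar `R̄† R̄` by the C*-identity. Standardness at the
identity equates it with `R† R`. -/
lemma norm_sigmaElt_leftUnitor_inv (x : D.Irr) :
    ‖sigmaElt (D.Rbar x) (λ_ (x : C)).inv‖ = catDim (D.R x) := by
  have h1 : rotate (D.Rbar x) (λ_ (x : C)).inv = (D.Rbar x)† := by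
    rw [rotate]; monoidal
  have h2 := (D.standard x).2 (𝟙 _)
  rw [whiskerLeft_id, id_whiskerRight, Category.id_comp, Category.id_comp] at h2
  change hnorm _ = _
  rw [sigmaElt, h1, cstar_identity, hnorm_dag, ← cstar_identity, ← h2,
    (unitScalar_comp_dag (D.R x)).1, hnorm_smul, hnorm_id unit_simple.1, Complex.norm_real,
    Real.norm_of_nonneg (unitScalar_comp_dag (D.R x)).2, mul_one, catDim]

lemma toTube_star (a : D.FusionAlgebra) :
    D.toTube (star a) = D.tubeStar (D.toTube a) := by
  funext k
  have h := (D.standard k).1.isDualPair.1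
  have h1 : tubeRotate (D.R k) ((D.Rbar k)†)
      ((λ_ (D.bar k : C)).hom ≫ (ρ_ (D.bar k : C)).inv) = (ρ_ (k : C)).hom ≫ (λ_ (k : C)).inv := by
    calc _ = 𝟙 _ ⊗≫ ((ρ_ (k : C)).inv ≫ (k : C) ◁ D.R k ≫ (α_ _ _ _).inv ≫
          ((D.Rbar k)†) ▷ (k : C) ≫ (λ_ (k : C)).hom) ⊗≫ 𝟙 _ := by
          rw [tubeRotate]; monoidal
      _ = _ := by rw [h]; monoidal
  rw [tubeStar_apply, toTube, coeff_star, toTube, ← h1]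
  simp only [tubeRotate, dag_smul, dag_comp, dag_leftUnitor_inv, dag_rightUnitor,
    MonoidalLinear.smul_whiskerRight, MonoidalLinear.whiskerLeft_smul, Linear.smul_comp,
    Linear.comp_smul]

variable [IsRigid C]

lemma coeff_mul (a b : D.FusionAlgebra) (k : D.Irr) :
    D.coeff (a * b) k = ∑ x ∈ (D.coeff a).support, ∑ y ∈ (D.coeff b).support,
      D.coeff a x * D.coeff b y * (onbFinset (k : C) ((x : C) ⊗ (y : C))).card := by
  classical
  rw [← coeffₗ_apply, mul_def, Finsupp.sum, map_sum]
  refine Finset.sum_congr rfl fun x _ => ?_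
  rw [Finsupp.sum, map_sum]
  refine Finset.sum_congr rfl fun y _ => ?_
  simp only [← fun z : D.Irr => card_onbFinset (D.simple _ z.2) ((x : C) ⊗ (y : C))]
  rw [map_smul, smul_eq_mul, finsum_eq_sum_of_support_subset (s := D.suppFinset ((x : C) ⊗ (y : C)))]
  · rw [map_sum]
    simp only [map_smul, coeffₗ_of, smul_eq_mul]
    rw [Finset.sum_eq_single k]
    · simp
    · intro z _ hz
      rw [if_neg hz, mul_zero]
    · intro h
      rw [D.onbFinset_eq_empty' h]
      simp
  · intro z hz
    by_contra h
    refine hz ?_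
    change ((onbFinset (z : C) ((x : C) ⊗ (y : C))).card : ℂ) • D.of z = 0
    rw [D.onbFinset_eq_empty' h, Finset.card_empty, Nat.cast_zero, zero_smul]

/-- Every basis vector `V` of `k ⟶ m ⊗ l` contributes the same term because `V ≫ V†` is the
identity; the fusion multiplicity counts them. -/
lemma toTube_mul (a b : D.FusionAlgebra) :
    D.toTube (a * b) = D.tubeMul (D.toTube a) (D.toTube b) := by
  funext k
  have h0 : ∀ (a : D.FusionAlgebra), ∀ m ∉ (D.coeff a).support, D.toTube a m = 0 :=
    fun a m hm => by rw [toTube, Finsupp.notMem_support_iff.1 hm, zero_smul]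
  rw [D.tubeMul_apply _ _ (h0 a) (h0 b), toTube, coeff_mul, Finset.sum_smul]
  refine Finset.sum_congr rfl fun m _ => ?_
  rw [Finset.sum_smul]
  refine Finset.sum_congr rfl fun l _ => ?_
  have h1 : ∀ V ∈ onbFinset (k : C) ((m : C) ⊗ (l : C)),
      V ▷ 𝟙_ C ≫ (α_ (m : C) (l : C) (𝟙_ C)).hom ≫ (m : C) ◁ D.toTube b l ≫
        (α_ (m : C) (𝟙_ C) (l : C)).inv ≫ D.toTube a m ▷ (l : C) ≫
        (α_ (𝟙_ C) (m : C) (l : C)).hom ≫ 𝟙_ C ◁ V† =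
      (D.coeff a m * D.coeff b l) • ((ρ_ (k : C)).hom ≫ (λ_ (k : C)).inv) := by
    intro V hV
    have h2 : V ▷ 𝟙_ C ≫ (α_ (m : C) (l : C) (𝟙_ C)).hom ≫
        (m : C) ◁ ((ρ_ (l : C)).hom ≫ (λ_ (l : C)).inv) ≫
        (α_ (m : C) (𝟙_ C) (l : C)).inv ≫ ((ρ_ (m : C)).hom ≫ (λ_ (m : C)).inv) ▷ (l : C) ≫
        (α_ (𝟙_ C) (m : C) (l : C)).hom ≫ 𝟙_ C ◁ V† =
        (ρ_ (k : C)).hom ≫ (V ≫ V†) ≫ (λ_ (k : C)).inv := by monoidal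
    rw [(isOrthonormal_onbFinset (D.simple _ k.2) _).1 V hV, Category.id_comp] at h2
    rw [← h2, toTube, toTube]
    simp only [MonoidalLinear.smul_whiskerRight, MonoidalLinear.whiskerLeft_smul,
      Linear.smul_comp, Linear.comp_smul, smul_smul]
  rw [Finset.sum_congr rfl h1, Finset.sum_const, ← Nat.cast_smul_eq_nsmul ℂ, smul_smul, mul_comm]

lemma toTube_smul_of (r : ℂ) (x : D.Irr) :
    D.toTube (r • D.of x) = D.Psi ((ρ_ (x : C)).hom ≫ (r • (λ_ (x : C)).inv)) := by
  rw [toTube_smul, toTube_of, Linear.comp_smul, Psi_smul]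

/-- The unit law is checked in the tube algebra, where the unitor `𝟙 ⊗ x ≅ x` is removed by
cyclicity of `Psi`. -/
lemma one_mul_smul_of (r : ℂ) (x : D.Irr) : (1 : D.FusionAlgebra) * r • D.of x = r • D.of x := by
  apply D.toTube_injective
  rw [toTube_mul, toTube_smul_of, toTube_one, tubeMul_Psi]
  have h : tubeComp (𝟙 (𝟙_ C ⊗ 𝟙_ C)) ((ρ_ (x : C)).hom ≫ (r • (λ_ (x : C)).inv)) =
      (λ_ (x : C)).hom ▷ 𝟙_ C ≫ ((ρ_ (x : C)).hom ≫ (r • (λ_ (x : C)).inv)) ≫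
        𝟙_ C ◁ (λ_ (x : C)).inv := by
    simp only [tubeComp, Linear.comp_smul, Linear.smul_comp, MonoidalLinear.whiskerLeft_smul]
    congr 1
    monoidal
  rw [h, Psi_cyclic, Category.assoc, ← MonoidalCategory.whiskerLeft_comp]
  simp

lemma smul_of_mul_one (r : ℂ) (x : D.Irr) : r • D.of x * (1 : D.FusionAlgebra) = r • D.of x := by
  apply D.toTube_injective
  rw [toTube_mul, toTube_smul_of, toTube_one, tubeMul_Psi]
  have h : tubeComp ((ρ_ (x : C)).hom ≫ (r • (λ_ (x : C)).inv)) (𝟙 (𝟙_ C ⊗ 𝟙_ C)) =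
      (ρ_ (x : C)).hom ▷ 𝟙_ C ≫ ((ρ_ (x : C)).hom ≫ (r • (λ_ (x : C)).inv)) ≫
        𝟙_ C ◁ (ρ_ (x : C)).inv := by
    simp only [tubeComp, Linear.comp_smul, Linear.smul_comp, MonoidalLinear.smul_whiskerRight]
    congr 1
    monoidal
  rw [h, Psi_cyclic, Category.assoc, ← MonoidalCategory.whiskerLeft_comp]
  simp

lemma star_mul_self_mem_sigmaSq (a : D.FusionAlgebra) : star a * a ∈ D.sigmaSq := by
  have h := D.tubeMul_tubeStar_mem_tubeCone (x := ⟨𝟙_ C, D.unit_mem⟩) (D.toTube_mem_tube (star a))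
  rw [← toTube_star, star_star', ← toTube_mul] at h
  exact h

/-- Multiples of simple objects are bounded in the order of the fusion algebra. -/
lemma smul_one_sub_star_mul_mem (x : D.Irr) (r : ℂ) :
    ((‖sigmaElt (D.Rbar x) (r • (λ_ (x : C)).inv)‖ * catDim (D.R x) : ℝ) : ℂ) •
      (1 : D.FusionAlgebra) - star (r • D.of x) * (r • D.of x) ∈ D.sigmaSq := by
  have h := D.smul_one_sub_tubeMul_tubeStar_mem (D.standard x).1 (r • (λ_ (x : C)).inv)
  rw [← toTube_smul_of, ← toTube_star, ← toTube_mul, ← toTube_smul, ← toTube_sub] at h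
  exact h

lemma exists_add_star_add_mem_sigmaSq (x : D.Irr) (r : ℂ) :
    ∃ t : ℝ, 0 ≤ t ∧
      r • D.of x + star (r • D.of x) + (t : ℂ) • (1 : D.FusionAlgebra) ∈ D.sigmaSq := by
  set s : ℝ := ‖sigmaElt (D.Rbar x) (r • (λ_ (x : C)).inv)‖ * catDim (D.R x) with hs
  have hs0 : 0 ≤ s := mul_nonneg (hnorm_nonneg _) (unitScalar_comp_dag (D.R x)).2
  -- The cross terms of this square are the wanted ones; adding `s 𝟙 - (r x)^* (r x)` cancels the
  -- quadratic term and leaves the constant `1 + s`.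
  have h1 := D.star_mul_self_mem_sigmaSq (1 + r • D.of x)
  have h2 := D.add_mem_sigmaSq h1 (D.smul_one_sub_star_mul_mem x r)
  refine ⟨1 + s, by linarith, ?_⟩
  have h11 : (1 : D.FusionAlgebra) * 1 = 1 := by
    have h := D.one_mul_smul_of 1 ⟨𝟙_ C, D.unit_mem⟩
    rwa [one_smul] at h
  have h3 : star (1 + r • D.of x) * (1 + r • D.of x) =
      1 + r • D.of x + star (r • D.of x) + star (r • D.of x) * (r • D.of x) := by
    rw [star_add', star_one', add_mul', mul_add', mul_add', one_mul_smul_of, h11, star_smul_of,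
      smul_of_mul_one]
    abel
  rw [h3, ← hs] at h2
  convert h2 using 1
  push_cast
  rw [add_smul, one_smul]
  abel

end IrrChoice

end Tensor

/-! ### The three statements -/

theorem mainTheorem3 {C : Type u} [Category.{v} C] [Preadditive C] [Linear ℂ C]
    [MonoidalCategory C] [CStarTensorCategory C] [IsRigid C] (D : IrrChoice C) :
    (∀ a : D.FusionAlgebra, star a = a →
      ∃ R : ℝ, 0 < R ∧ a + (R : ℂ) • (1 : D.FusionAlgebra) ∈ D.sigmaSq) ∧
    (∀ (x : D.Irr) (z zbar : C) (R : 𝟙_ C ⟶ zbar ⊗ z) (Rbar : 𝟙_ C ⟶ z ⊗ zbar),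
      IsStandard R Rbar → ∀ γ : z ⟶ (x : C) ⊗ z,
        ((‖sigmaElt Rbar γ‖ * catDim R : ℝ) : ℂ) • D.toTube 1
          - D.tubeMul (D.tubeStar (D.Psi ((ρ_ z).hom ≫ γ))) (D.Psi ((ρ_ z).hom ≫ γ))
          ∈ D.tubeCone) ∧
    (∀ z : D.Irr,
      ((catDim (D.R z) ^ 2 : ℝ) : ℂ) • (1 : D.FusionAlgebra) - D.of (D.bar z) * D.of z
        ∈ D.sigmaSq) := by
  refine ⟨fun a ha => ?_, fun x z zbar R Rbar h γ => D.smul_one_sub_tubeMul_tubeStar_mem h.1 γ,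
    fun z => ?_⟩
  · have key : ∀ s : Finset D.Irr, ∃ t : ℝ, 0 < t ∧
        ∑ x ∈ s, ((D.coeff a x / 2) • D.of x + star ((D.coeff a x / 2) • D.of x)) +
          (t : ℂ) • (1 : D.FusionAlgebra) ∈ D.sigmaSq := by
      classical
      intro s
      induction s using Finset.induction_on with
      | empty =>
        -- Starting from `1` rather than `0` keeps the final constant strictly positive.
        refine ⟨1, one_pos, ?_⟩
        have h := D.star_mul_self_mem_sigmaSq (1 : D.FusionAlgebra)
        have h1 := D.one_mul_smul_of 1 ⟨𝟙_ C, D.unit_mem⟩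
        rw [one_smul] at h1
        rw [D.star_one', show (1 : D.FusionAlgebra) * 1 = 1 from h1] at h
        simpa using h
      | insert x s hx ih =>
        obtain ⟨t, ht, hm⟩ := ih
        obtain ⟨t', ht', hm'⟩ := D.exists_add_star_add_mem_sigmaSq x (D.coeff a x / 2)
        refine ⟨t' + t, by linarith, ?_⟩
        have h := D.add_mem_sigmaSq hm' hm
        rw [Finset.sum_insert hx]
        convert h using 1
        push_cast
        rw [add_smul]
        abel
    obtain ⟨t, ht, h⟩ := key (D.coeff a).support
    refine ⟨t, ht, ?_⟩
    convert h using 2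
    let S : D.FusionAlgebra →+ D.FusionAlgebra := AddMonoidHom.mk' star D.star_add'
    -- `b` is half of `a`, hence self-adjoint, and `b + b^* = a` matches the symmetrised sum bounded
    -- in `key`.
    set b : D.FusionAlgebra := ∑ x ∈ (D.coeff a).support, (D.coeff a x / 2) • D.of x with hb
    have h1 : b + b = a := by
      conv_rhs => rw [D.eq_sum_smul_of a]
      rw [hb, ← Finset.sum_add_distrib]
      refine Finset.sum_congr rfl fun x _ => ?_
      rw [← add_smul, add_halves]
    have h2 : star b = b := by
      have h3 : star b + star b = b + b := by rw [← D.star_add', h1, ha]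
      rw [← two_smul ℂ, ← two_smul ℂ b] at h3
      exact smul_right_injective _ two_ne_zero h3
    rw [Finset.sum_add_distrib, ← hb]
    have h4 : ∑ x ∈ (D.coeff a).support, star ((D.coeff a x / 2) • D.of x) = star b :=
      (map_sum S _ _).symm
    rw [h4, h2, h1]
  · have h := D.smul_one_sub_star_mul_mem z 1
    rw [one_smul, one_smul, D.norm_sigmaElt_leftUnitor_inv, D.star_of, ← sq] at h
    exact h
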